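/- **Theorem (Equidistribution of Statistics I).** A set partition of $[n]=\{1,\dots,n\}$ is a collection of nonempty, pairwise disjoint blocks with union $[n]$, written $\sigma=B_1/B_2/\cdots/B_m$ with $\min B_1<\min B_2<\cdots<\min B_m$. Its restricted growth function is the word $w(\sigma)=w_1w_2\cdots w_n$ with $w_i=j$ if $i\in B_j$. For $A\subseteq[n]$, the subpartition $A\cap\sigma$ consists of the nonempty sets among the $A\cap B_j$; its standardization is obtained by replacing the smallest element of $A$ by $1$, the next smallest by $2$, and so on. The partition $\sigma$ avoids a pattern (set partition) $\pi$ if no subpartition of $\sigma$ standardizes to $\pi$, and $$R_n(\pi)=\{w(\sigma):\sigma\text{ is a set partition of }[n]\text{ that avoids }\pi\}.$$ For a word $w=w_1\cdots w_n$ put $$\mathrm{ls}(w)=\sum_{i=1}^n|\{w_j<w_i:j<i\}|,\qquad \mathrm{lb}(w)=\sum_{i=1}^n|\{w_j>w_i:j<i\}|,$$ $$\mathrm{rs}(w)=\sum_{i=1}^n|\{w_j<w_i:j>i\}|,\qquad \mathrm{rb}(w)=\sum_{i=1}^n|\{w_j>w_i:j>i\}|,$$ where each set is a set of letters, so that equal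 letters $w_j$ are counted only once. Let $13/2/4$ and $1/24/3$ denote the set partitions of $[4]$ with blocks $\{1,3\},\{2\},\{4\}$ and $\{1\},\{2,4\},\{3\}$. Then for every integer $n\ge 0$ and every integer $v\ge 0$: 1. $\#\{w\in R_n(13/2/4):\mathrm{ls}(w)=v\}=\#\{w\in R_n(1/24/3):\mathrm{rb}(w)=v\}$; 2. $\#\{w\in R_n(13/2/4):\mathrm{rb}(w)=v\}=\#\{w\in R_n(1/24/3):\mathrm{ls}(w)=v\}$; 3. $\#\{w\in R_n(13/2/4):\mathrm{lb}(w)=v\}=\#\{w\in R_n(1/24/3):\mathrm{lb}(w)=v\}$; 4. $\#\{w\in R_n(13/2/4):\mathrm{rs}(w)=v\}=\#\{w\in R_n(1/24/3):\mathrm{rs}(w)=v\}$. -/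

import Mathlib

/-- A set partition of `[n] = {1, …, n}`: a collection of nonempty, pairwise disjoint blocks whose
union is `[n]`. -/
abbrev SetPartition (n : ℕ) : Type := Finpartition (Finset.Icc 1 n)

namespace SetPartition

/-- The blocks of the subpartition `A ∩ σ`: the nonempty sets `A ∩ B`, for `B` a block of `σ`. -/
def restrictBlocks {n : ℕ} (σ : SetPartition n) (A : Finset ℕ) : Finset (Finset ℕ) :=
  (σ.parts.image (fun B => A ∩ B)).erase ∅

/-- The position of `x` in the increasing enumeration of `A`: for `x ∈ A`, the value is `1` if `x`
is the smallest element of `A`, `2` if it is the next smallest, and so on. -/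
def rank (A : Finset ℕ) (x : ℕ) : ℕ := (A.filter (fun a => a ≤ x)).card

/-- The blocks of the standardization of the subpartition `A ∩ σ`, a partition of
`{1, …, A.card}`. -/
def standardizedBlocks {n : ℕ} (σ : SetPartition n) (A : Finset ℕ) : Finset (Finset ℕ) :=
  (σ.restrictBlocks A).image (fun B => B.image (rank A))

/-- `σ` contains the pattern `π`: some subpartition of `σ` standardizes to `π`. -/
def Contains {n k : ℕ} (σ : SetPartition n) (π : SetPartition k) : Prop :=
  ∃ A : Finset ℕ, A ⊆ Finset.Icc 1 n ∧ σ.standardizedBlocks A = π.parts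

/-- `σ` avoids the pattern `π`: no subpartition of `σ` standardizes to `π`. -/
def Avoids {n k : ℕ} (σ : SetPartition n) (π : SetPartition k) : Prop := ¬ σ.Contains π

/-- If the blocks of `σ` are listed as `B₁, B₂, …, Bₘ` with `min B₁ < min B₂ < … < min Bₘ`, this is
the index `j` of the block `Bⱼ` that contains `x`, i.e. the number of blocks whose minimum is at
most that of the block of `x`. -/
def blockIndex {n : ℕ} (σ : SetPartition n) (x : ℕ) : ℕ :=
  (σ.parts.filter (fun B => B.min ≤ (σ.part x).min)).card

/-- The restricted growth function `w(σ) = w₁ w₂ … wₙ` of `σ`, where `wₓ = j` if `x` lies in the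
`j`-th block. The positions `1, …, n` of a word of length `n` are indexed by `Fin n`, so that
`i : Fin n` stands for the position `i + 1`. -/
def toWord {n : ℕ} (σ : SetPartition n) : Fin n → ℕ := fun i => σ.blockIndex (i + 1)

/-- The pattern `13/2/4`. -/
def pattern13_2_4 : SetPartition 4 where
  parts := {{1, 3}, {2}, {4}}
  supIndep := by decide
  sup_parts := by decide
  bot_notMem := by decide

/-- The pattern `1/24/3`. -/
def pattern1_24_3 : SetPartition 4 where
  parts := {{1}, {2, 4}, {3}}
  supIndep := by decide
  sup_parts := by decide
  bot_notMem := by decide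

end SetPartition

/-- `Rₙ(π)`: the set of the words `w(σ)` of the set partitions `σ` of `[n]` that avoid `π`. -/
def avoidanceWords (n : ℕ) {k : ℕ} (π : SetPartition k) : Set (Fin n → ℕ) :=
  {w | ∃ σ : SetPartition n, σ.Avoids π ∧ σ.toWord = w}

/-- There are only finitely many set partitions of `[n]`, hence `Rₙ(π)` is finite. -/
theorem avoidanceWords_finite (n : ℕ) {k : ℕ} (π : SetPartition k) :
    (avoidanceWords n π).Finite :=
  (Set.finite_range (fun σ : SetPartition n => σ.toWord)).subset
    (fun _ ⟨σ, _, hw⟩ => ⟨σ, hw⟩)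

namespace WachsWhite

/-- Left and smaller: the sum over the positions `i` of the number of distinct letters to the left
of position `i` that are smaller than `wᵢ`. -/
def ls {n : ℕ} (w : Fin n → ℕ) : ℕ :=
  ∑ i : Fin n, (((Finset.univ.filter (fun j => j < i)).image w).filter (fun a => a < w i)).card

/-- Left and bigger. -/
def lb {n : ℕ} (w : Fin n → ℕ) : ℕ :=
  ∑ i : Fin n, (((Finset.univ.filter (fun j => j < i)).image w).filter (fun a => w i < a)).card

/-- Right and smaller. -/
def rs {n : ℕ} (w : Fin n → ℕ) : ℕ :=
  ∑ i : Fin n, (((Finset.univ.filter (fun j => i < j)).image w).filter (fun a => a < w i)).card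

/-- Right and bigger. -/
def rb {n : ℕ} (w : Fin n → ℕ) : ℕ :=
  ∑ i : Fin n, (((Finset.univ.filter (fun j => i < j)).image w).filter (fun a => w i < a)).card

end WachsWhite

/-- The statistic `s` on the (finite) set of words `R` and the statistic `t` on the (finite) set of
words `R'` have the same distribution: each value is taken by `s` on `R` as often as by `t` on
`R'`. -/
def Equidistributed {n : ℕ} (s : (Fin n → ℕ) → ℕ) (R : Set (Fin n → ℕ))
    (t : (Fin n → ℕ) → ℕ) (R' : Set (Fin n → ℕ)) : Prop :=
  ∀ v : ℕ, {w ∈ R | s w = v}.ncard = {w ∈ R' | t w = v}.ncard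

/-!
Write `P ⊕ Q` for the word `P` followed by the word `Q` with its letters raised by the number of
distinct letters of `P` (`shiftAppend`). The words of both avoidance classes are built from the same
pieces:

* layered words `P = 1 ⋯ 1 2 ⋯ 2 ⋯ r ⋯ r`;
* cores `Q`, which are either binary words over `{1, 2}` starting with `1` or words
  `1 ⋯ 1 2 ⋯ 2 ⋯ s ⋯ s 1 ⋯ 1`, in both cases not weakly increasing; the empty word is allowed too.

The words avoiding `13/2/4` are the words `P ⊕ Q`, those avoiding `1/24/3` are the words `Q ⊕ P`,
and in each case `P` and `Q` are determined by the word (`LayeredCorePair.bijOn_layeredFirst` and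
`LayeredCorePair.bijOn_coreFirst`). That every avoiding word has this form is seen by adding its
letters one at a time; uniqueness holds because a core has a letter to the left of a `1` that is
greater than `1`.

In a direct sum all letters of the left summand are smaller than those of the right one. Hence `lb`
and `rs` are additive, and `P ⊕ Q ↦ Q ⊕ P` preserves both.

For `ls` and `rb`, write a core as `Q = c 1ᵗ`, where `c` ends with the last maximum of `Q`, and let
`Q'` be `c' 1ᵗ` with `c'` the reverse complement of `c`; this is again a core. Reverse
complementation exchanges `ls` and `rb`, and the final `1ᵗ` contributes to neither. In a direct sum,
`ls` has the extra term (number of letters of the left summand) times (length of the right one), and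
`rb` the term (length of the left summand) times (number of letters of the right one). So if `P'` is
the reverse complement of `P`, the map `P ⊕ Q ↦ Q' ⊕ P'` (`LayeredCorePair.dual`) exchanges `ls`
and `rb`.

All this takes place for words as lists. Set partitions are identified with their restricted growth
functions in `mem_avoidanceWords_iff`, where containment of a pattern becomes a condition on which
letters of the word are equal.
-/

/-! ### Set partitions and restricted growth functions -/

/-- A word `w` is a restricted growth function: its letters are positive, and every positive letter
smaller than `w i` occurs to the left of position `i`. -/
def IsRestrictedGrowth {n : ℕ} (w : Fin n → ℕ) : Prop :=
  ∀ i, 1 ≤ w i ∧ ∀ v, 1 ≤ v → v < w i → ∃ j < i, w j = v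

theorem IsRestrictedGrowth.eq_of_kernel_eq {n : ℕ} {w w' : Fin n → ℕ} (hw : IsRestrictedGrowth w)
    (hw' : IsRestrictedGrowth w') (h : ∀ i j, w i = w j ↔ w' i = w' j) : w = w' := by
  funext i
  induction i using WellFoundedLT.induction with
  | ind i ih =>
    rcases lt_trichotomy (w i) (w' i) with hlt | heq | hlt
    · obtain ⟨j, hj, hjv⟩ := (hw' i).2 (w i) (hw i).1 hlt
      have := (h j i).1 ((ih j hj).trans hjv)
      omega
    · exact heq
    · obtain ⟨j, hj, hjv⟩ := (hw i).2 (w' i) (hw' i).1 hlt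
      have := (h j i).2 ((ih j hj).symm.trans hjv)
      omega

namespace SetPartition

variable {n : ℕ}

theorem succ_mem_Icc (i : Fin n) : (i : ℕ) + 1 ∈ Finset.Icc 1 n := by
  have := i.2
  simp only [Finset.mem_Icc]
  omega

theorem eq_of_min_eq (σ : SetPartition n) {B C : Finset ℕ} (hB : B ∈ σ.parts) (hC : C ∈ σ.parts)
    (h : B.min = C.min) : B = C := by
  obtain ⟨b, hb⟩ := Finset.min_of_nonempty (σ.nonempty_of_mem_parts hB)
  exact σ.eq_of_mem_parts hB hC (Finset.mem_of_min hb) (Finset.mem_of_min (h ▸ hb))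

theorem blockIndex_lt_of_min_lt (σ : SetPartition n) {x y : ℕ} (hy : y ∈ Finset.Icc 1 n)
    (h : (σ.part x).min < (σ.part y).min) : σ.blockIndex x < σ.blockIndex y := by
  refine Finset.card_lt_card ((Finset.ssubset_iff_of_subset ?_).2 ⟨σ.part y, ?_, ?_⟩)
  · exact Finset.monotone_filter_right _ fun B _ hB => hB.trans h.le
  · exact Finset.mem_filter.2 ⟨σ.part_mem.2 hy, le_rfl⟩
  · exact fun hmem => (Finset.mem_filter.1 hmem).2.not_gt h

theorem blockIndex_eq_iff (σ : SetPartition n) {x y : ℕ} (hx : x ∈ Finset.Icc 1 n)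
    (hy : y ∈ Finset.Icc 1 n) : σ.blockIndex x = σ.blockIndex y ↔ σ.part x = σ.part y := by
  constructor
  · intro h
    rcases lt_trichotomy (σ.part x).min (σ.part y).min with hlt | heq | hlt
    · exact absurd h (σ.blockIndex_lt_of_min_lt hy hlt).ne
    · exact σ.eq_of_min_eq (σ.part_mem.2 hx) (σ.part_mem.2 hy) heq
    · exact absurd h (σ.blockIndex_lt_of_min_lt hx hlt).ne'
  · intro h
    simp only [blockIndex, h]

theorem toWord_eq_iff (σ : SetPartition n) (i j : Fin n) :
    σ.toWord i = σ.toWord j ↔ σ.part (i + 1) = σ.part (j + 1) :=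
  σ.blockIndex_eq_iff (succ_mem_Icc i) (succ_mem_Icc j)

theorem isRestrictedGrowth_toWord (σ : SetPartition n) : IsRestrictedGrowth σ.toWord := by
  intro i
  have hi := succ_mem_Icc i
  constructor
  · exact Finset.card_pos.2 ⟨_, Finset.mem_filter.2 ⟨σ.part_mem.2 hi, le_rfl⟩⟩
  · intro v hv1 hv
    -- Counting: the blocks that do not start after that of `i + 1` have pairwise different
    -- indices in `{1, …, wᵢ}`, and there are `wᵢ` of them, so every index occurs.
    set F := σ.parts.filter (fun B => B.min ≤ (σ.part (i + 1)).min) with hF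
    let ind : Finset ℕ → ℕ := fun B => (σ.parts.filter (fun C => C.min ≤ B.min)).card
    have hsurj : Set.SurjOn ind F (Finset.Icc 1 (σ.toWord i)) := by
      refine Finset.surjOn_of_injOn_of_card_le ind ?_ ?_ ?_
      · intro B hB
        simp only [hF, Finset.coe_filter, Set.mem_ofPred_eq] at hB
        simp only [Finset.coe_Icc, Set.mem_Icc]
        refine ⟨Finset.card_pos.2 ⟨B, Finset.mem_filter.2 ⟨hB.1, le_rfl⟩⟩, ?_⟩
        exact Finset.card_le_card (Finset.monotone_filter_right _ fun C _ hC => hC.trans hB.2)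
      · intro B hB C hC hBC
        simp only [hF, Finset.coe_filter, Set.mem_ofPred_eq] at hB hC
        obtain ⟨b, hb⟩ := σ.nonempty_of_mem_parts hB.1
        obtain ⟨c, hc⟩ := σ.nonempty_of_mem_parts hC.1
        have eb := σ.part_eq_of_mem hB.1 hb
        have ec := σ.part_eq_of_mem hC.1 hc
        have := (σ.blockIndex_eq_iff (σ.le hB.1 hb) (σ.le hC.1 hc)).1
          (by simpa only [blockIndex, eb, ec] using hBC)
        rw [← eb, ← ec, this]
      · simp [toWord, blockIndex, hF]
    obtain ⟨B, hB, hBv⟩ := hsurj (show v ∈ _ by simp; omega)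
    simp only [hF, Finset.coe_filter, Set.mem_ofPred_eq] at hB
    obtain ⟨b, hb⟩ := Finset.min_of_nonempty (σ.nonempty_of_mem_parts hB.1)
    have hbB := Finset.mem_of_min hb
    have hbn := σ.le hB.1 hbB
    have hbi : b ≤ i + 1 := by
      have h1 : (σ.part (i + 1)).min ≤ ((i + 1 : ℕ) : WithTop ℕ) :=
        Finset.min_le (σ.mem_part_self.2 hi)
      have h2 := hB.2.trans h1
      rw [hb] at h2
      exact WithTop.coe_le_coe.1 h2
    have hindex : σ.blockIndex b = v := by
      rw [← hBv, blockIndex, σ.part_eq_of_mem hB.1 hbB]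
    have hne : b ≠ i + 1 := by
      rintro rfl
      exact hv.ne hindex.symm
    simp only [Finset.mem_Icc] at hbn
    have hb1 : b - 1 + 1 = b := by omega
    refine ⟨⟨b - 1, by omega⟩, ?_, ?_⟩
    · rw [Fin.lt_def]
      simp only
      omega
    · simpa only [toWord, hb1] using hindex

theorem exists_toWord_eq {w : Fin n → ℕ} (hw : IsRestrictedGrowth w) :
    ∃ σ : SetPartition n, σ.toWord = w := by
  classical
  let f : ℕ → ℕ := fun x => if h : x - 1 < n then w ⟨x - 1, h⟩ else 0
  have hf : ∀ i : Fin n, f (i + 1) = w i := fun i => by simp [f]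
  let σ : SetPartition n := Finpartition.ofSetSetoid (Setoid.ker f) (Finset.Icc 1 n)
  refine ⟨σ, σ.isRestrictedGrowth_toWord.eq_of_kernel_eq hw fun i j => ?_⟩
  rw [toWord_eq_iff, ← σ.mem_part_iff_part_eq_part (succ_mem_Icc i) (succ_mem_Icc j),
    Finpartition.mem_part_ofSetSetoid_iff_rel]
  have hi := succ_mem_Icc i
  have hj := succ_mem_Icc j
  simp only [hi, hj, Setoid.ker_def, hf, true_and]
  exact eq_comm

/-! ### Pattern containment in terms of words -/

theorem rank_lt_rank {A : Finset ℕ} {x y : ℕ} (hy : y ∈ A) (h : x < y) : rank A x < rank A y := by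
  refine Finset.card_lt_card ((Finset.ssubset_iff_of_subset ?_).2 ⟨y, ?_, ?_⟩)
  · exact Finset.monotone_filter_right _ fun a _ ha => le_trans ha h.le
  · simpa using hy
  · simp [h]

theorem rank_injOn (A : Finset ℕ) : Set.InjOn (rank A) A := by
  intro x hx y hy h
  rcases lt_trichotomy x y with hlt | heq | hlt
  · exact absurd h (rank_lt_rank hy hlt).ne
  · exact heq
  · exact absurd h (rank_lt_rank hx hlt).ne'

theorem rank_orderEmbOfFin {A : Finset ℕ} {k : ℕ} (hA : A.card = k) (i : Fin k) :
    rank A (A.orderEmbOfFin hA i) = i + 1 := by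
  have : A.filter (fun a => a ≤ A.orderEmbOfFin hA i)
      = (Finset.Iic i).image (A.orderEmbOfFin hA) := by
    ext a
    simp only [Finset.mem_filter, Finset.mem_image, Finset.mem_Iic]
    constructor
    · rintro ⟨ha, hai⟩
      have : a ∈ Set.range (A.orderEmbOfFin hA) := by simpa using ha
      obtain ⟨j, rfl⟩ := this
      exact ⟨j, by simpa using hai, rfl⟩
    · rintro ⟨j, hj, rfl⟩
      exact ⟨Finset.orderEmbOfFin_mem A hA j, by simpa using hj⟩
  rw [rank, this, Finset.card_image_of_injective _ (A.orderEmbOfFin hA).injective, Fin.card_Iic]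

theorem standardizedBlocks_eq_image (σ : SetPartition n) {A : Finset ℕ}
    (hA : A ⊆ Finset.Icc 1 n) : σ.standardizedBlocks A =
      A.image (fun x => (A.filter (fun y => σ.part y = σ.part x)).image (rank A)) := by
  have key : ∀ x ∈ A, A ∩ σ.part x = A.filter (fun y => σ.part y = σ.part x) := by
    intro x hx
    ext y
    simp only [Finset.mem_inter, Finset.mem_filter, and_congr_right_iff]
    intro hy
    rw [σ.mem_part_iff_part_eq_part (hA hy) (hA hx)]
  have : σ.restrictBlocks A = A.image (fun x => A.filter (fun y => σ.part y = σ.part x)) := by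
    ext S
    simp only [restrictBlocks, Finset.mem_erase, Finset.mem_image]
    constructor
    · rintro ⟨hne, B, hB, rfl⟩
      obtain ⟨x, hx⟩ := Finset.nonempty_iff_ne_empty.2 hne
      rw [Finset.mem_inter] at hx
      exact ⟨x, hx.1, by rw [← key x hx.1, σ.part_eq_of_mem hB hx.2]⟩
    · rintro ⟨x, hx, rfl⟩
      refine ⟨Finset.nonempty_iff_ne_empty.1 ⟨x, by simp [hx]⟩, σ.part x,
        σ.part_mem.2 (hA hx), key x hx⟩
  rw [standardizedBlocks, this, Finset.image_image]
  rfl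

theorem parts_eq_image_part (π : SetPartition n) :
    π.parts = (Finset.univ : Finset (Fin n)).image (fun i : Fin n =>
      ((Finset.univ : Finset (Fin n)).filter
        (fun j : Fin n => π.part (j + 1) = π.part (i + 1))).image (fun j : Fin n => (j : ℕ) + 1)) := by
  have key : ∀ i : Fin n, π.part (i + 1) = ((Finset.univ : Finset (Fin n)).filter
      (fun j : Fin n => π.part (j + 1) = π.part (i + 1))).image (fun j : Fin n => (j : ℕ) + 1) := by
    intro i
    ext y
    simp only [Finset.mem_image, Finset.mem_filter, Finset.mem_univ, true_and]
    constructor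
    · intro hy
      have hyn := π.part_subset _ hy
      rw [π.mem_part_iff_part_eq_part hyn (succ_mem_Icc i)] at hy
      rw [Finset.mem_Icc] at hyn
      have : y - 1 + 1 = y := by omega
      exact ⟨⟨y - 1, by omega⟩, by simpa only [this] using hy, this⟩
    · rintro ⟨j, hj, rfl⟩
      exact (π.mem_part_iff_part_eq_part (succ_mem_Icc j) (succ_mem_Icc i)).2 hj
  ext B
  simp only [Finset.mem_image, Finset.mem_univ, true_and, ← key]
  constructor
  · intro hB
    obtain ⟨x, hx⟩ := π.nonempty_of_mem_parts hB
    have hxn := π.le hB hx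
    rw [Finset.mem_Icc] at hxn
    refine ⟨⟨x - 1, by omega⟩, π.part_eq_of_mem hB ?_⟩
    have : x - 1 + 1 = x := by omega
    simpa only [this] using hx
  · rintro ⟨i, rfl⟩
    exact π.part_mem.2 (succ_mem_Icc i)

/-- Containment of a pattern is containment of an order-isomorphic copy of its equality pattern in
the word. -/
theorem contains_iff_exists_orderEmbedding {k : ℕ} (σ : SetPartition n) (π : SetPartition k) :
    σ.Contains π ↔ ∃ f : Fin k ↪o Fin n, ∀ i j,
      σ.toWord (f i) = σ.toWord (f j) ↔ π.part (i + 1) = π.part (j + 1) := by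
  constructor
  · rintro ⟨A, hA, h⟩
    have hcover : A.image (rank A) = Finset.Icc 1 k := by
      rw [← π.biUnion_parts, ← h, standardizedBlocks_eq_image σ hA]
      ext y
      simp only [Finset.mem_image, Finset.mem_biUnion, id]
      constructor
      · rintro ⟨x, hx, rfl⟩
        exact ⟨_, ⟨x, hx, rfl⟩, Finset.mem_image_of_mem _ (by simp [hx])⟩
      · rintro ⟨_, ⟨x, hx, rfl⟩, hy⟩
        obtain ⟨z, hz, rfl⟩ := Finset.mem_image.1 hy
        exact ⟨z, (Finset.mem_filter.1 hz).1, rfl⟩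
    have hcard : A.card = k := by
      rw [← Finset.card_image_of_injOn (rank_injOn A), hcover]
      simp
    have hsame : ∀ x ∈ A, ∀ y ∈ A,
        σ.part x = σ.part y ↔ π.part (rank A x) = π.part (rank A y) := by
      intro x hx y hy
      have hmem : ∀ z ∈ A, rank A z ∈ Finset.Icc 1 k := fun z hz =>
        hcover ▸ Finset.mem_image_of_mem _ hz
      have hpart : (A.filter (fun z => σ.part z = σ.part y)).image (rank A) ∈ π.parts := by
        rw [← h, standardizedBlocks_eq_image σ hA]
        exact Finset.mem_image_of_mem _ hy
      have hy' : rank A y ∈ (A.filter (fun z => σ.part z = σ.part y)).image (rank A) :=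
        Finset.mem_image_of_mem _ (by simp [hy])
      rw [← π.mem_part_iff_part_eq_part (hmem x hx) (hmem y hy), π.part_eq_of_mem hpart hy']
      simp only [Finset.mem_image, Finset.mem_filter]
      constructor
      · exact fun hxy => ⟨x, ⟨hx, hxy⟩, rfl⟩
      · rintro ⟨z, ⟨hz, hzy⟩, hzx⟩
        rwa [← rank_injOn A hz hx hzx]
    have hpos : ∀ i : Fin k, 1 ≤ A.orderEmbOfFin hcard i ∧ A.orderEmbOfFin hcard i ≤ n := fun i =>
      Finset.mem_Icc.1 (hA (A.orderEmbOfFin_mem hcard i))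
    let g : Fin k → Fin n := fun i => ⟨A.orderEmbOfFin hcard i - 1, by have := hpos i; omega⟩
    have hg : ∀ i, (g i : ℕ) + 1 = A.orderEmbOfFin hcard i := fun i =>
      Nat.sub_add_cancel (hpos i).1
    have hmono : StrictMono g := by
      intro i j hij
      have h1 : A.orderEmbOfFin hcard i < A.orderEmbOfFin hcard j :=
        (A.orderEmbOfFin hcard).lt_iff_lt.2 hij
      have h2 := hg i
      have h3 := hg j
      rw [Fin.lt_def]
      omega
    refine ⟨OrderEmbedding.ofStrictMono g hmono, fun i j => ?_⟩
    rw [OrderEmbedding.coe_ofStrictMono, toWord_eq_iff, hg, hg,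
      hsame _ (A.orderEmbOfFin_mem hcard i) _ (A.orderEmbOfFin_mem hcard j),
      rank_orderEmbOfFin, rank_orderEmbOfFin]
  · rintro ⟨f, hf⟩
    have hinj : Function.Injective (fun i : Fin k => (f i : ℕ) + 1) := by
      intro i j hij
      simpa [Fin.val_inj] using hij
    let A : Finset ℕ := Finset.univ.image (fun i : Fin k => (f i : ℕ) + 1)
    have hA : A ⊆ Finset.Icc 1 n := by
      intro x hx
      obtain ⟨i, -, rfl⟩ := Finset.mem_image.1 hx
      exact succ_mem_Icc (f i)
    have hrank : ∀ i : Fin k, rank A ((f i : ℕ) + 1) = i + 1 := by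
      intro i
      have : A.filter (fun a => a ≤ (f i : ℕ) + 1)
          = (Finset.Iic i).image (fun i : Fin k => (f i : ℕ) + 1) := by
        ext a
        simp only [A, Finset.mem_filter, Finset.mem_image, Finset.mem_univ, true_and,
          Finset.mem_Iic]
        constructor
        · rintro ⟨⟨j, rfl⟩, hj⟩
          exact ⟨j, by simpa using hj, rfl⟩
        · rintro ⟨j, hj, rfl⟩
          exact ⟨⟨j, rfl⟩, by simpa using hj⟩
      rw [rank, this, Finset.card_image_of_injective _ hinj, Fin.card_Iic]
    refine ⟨A, hA, ?_⟩
    rw [standardizedBlocks_eq_image σ hA, parts_eq_image_part π]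
    simp only [A, Finset.image_image]
    refine Finset.image_congr fun i _ => ?_
    simp only [Function.comp, ← hf, toWord_eq_iff]
    rw [Finset.filter_image, Finset.image_image]
    exact Finset.image_congr fun j _ => hrank j

end SetPartition

/-- The avoidance words are the restricted growth functions without a copy of the equality pattern
of `π`. -/
theorem mem_avoidanceWords_iff {n k : ℕ} (π : SetPartition k) (w : Fin n → ℕ) :
    w ∈ avoidanceWords n π ↔ IsRestrictedGrowth w ∧
      ¬ ∃ f : Fin k ↪o Fin n, ∀ i j, w (f i) = w (f j) ↔ π.part (i + 1) = π.part (j + 1) := by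
  constructor
  · rintro ⟨σ, hσ, rfl⟩
    exact ⟨σ.isRestrictedGrowth_toWord, fun h => hσ (σ.contains_iff_exists_orderEmbedding π |>.2 h)⟩
  · rintro ⟨hw, h⟩
    obtain ⟨σ, rfl⟩ := SetPartition.exists_toWord_eq hw
    exact ⟨σ, fun hσ => h (σ.contains_iff_exists_orderEmbedding π |>.1 hσ), rfl⟩

/-! ### Words as lists -/

/-- The number of pairs of a position of the word and a letter occurring to the right of it to
which the letter at that position is `R`-related. With `<` and `>` for `R` this gives the statistics
`rb` and `rs`; on the reversed word it gives `lb` and `ls`. -/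
def rightCount (R : ℕ → ℕ → Prop) [DecidableRel R] : List ℕ → ℕ
  | [] => 0
  | x :: l => (l.toFinset.filter (R x)).card + rightCount R l

section rightCount

variable {R S : ℕ → ℕ → Prop} [DecidableRel R] [DecidableRel S]

theorem rightCount_ofFn {n : ℕ} (w : Fin n → ℕ) : rightCount R (List.ofFn w) =
    ∑ i : Fin n, (((Finset.univ.filter (fun j => i < j)).image w).filter (R (w i))).card := by
  induction n with
  | zero => simp [rightCount]
  | succ n ih =>
    rw [List.ofFn_succ, rightCount, ih, Fin.sum_univ_succ]
    congr 1
    · congr 2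
      ext v
      simp [Fin.exists_fin_succ, List.mem_ofFn, Fin.succ_pos]
    · refine Finset.sum_congr rfl fun i _ => ?_
      congr 2
      ext v
      simp [Fin.exists_fin_succ]

theorem rightCount_append_of_forall (hR : ∀ x, ¬ R x x) {P Q : List ℕ}
    (h : ∀ p ∈ P, ∀ q ∈ Q, R p q) :
    rightCount R (P ++ Q) = rightCount R P + P.length * Q.toFinset.card + rightCount R Q := by
  induction P with
  | nil => simp [rightCount]
  | cons x P ih =>
    have hx : ((P ++ Q).toFinset.filter (R x)).card
        = (P.toFinset.filter (R x)).card + Q.toFinset.card := by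
      rw [List.toFinset_append, Finset.filter_union, Finset.card_union_of_disjoint]
      · congr 2
        refine Finset.filter_true_of_mem fun q hq => h x (by simp) q (by simpa using hq)
      · rw [Finset.disjoint_left]
        intro y hy hy'
        simp only [Finset.mem_filter, List.mem_toFinset] at hy hy'
        exact hR y (h y (by simp [hy.1]) y hy'.1)
    rw [List.cons_append, rightCount, rightCount, hx, ih fun p hp => h p (by simp [hp]),
      List.length_cons]
    ring

theorem rightCount_append_of_forall_not {P Q : List ℕ} (h : ∀ p ∈ P, ∀ q ∈ Q, ¬ R p q) :
    rightCount R (P ++ Q) = rightCount R P + rightCount R Q := by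
  induction P with
  | nil => simp [rightCount]
  | cons x P ih =>
    have hx : (P ++ Q).toFinset.filter (R x) = P.toFinset.filter (R x) := by
      rw [List.toFinset_append, Finset.filter_union, Finset.union_eq_left]
      intro q hq
      simp only [Finset.mem_filter, List.mem_toFinset] at hq
      exact absurd hq.2 (h x (by simp) q hq.1)
    rw [List.cons_append, rightCount, rightCount, hx, ih fun p hp => h p (by simp [hp])]
    ring

theorem rightCount_map {f : ℕ → ℕ} {l : List ℕ} (hf : Set.InjOn f {x | x ∈ l})
    (h : ∀ x ∈ l, ∀ y ∈ l, R (f x) (f y) ↔ S x y) :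
    rightCount R (l.map f) = rightCount S l := by
  induction l with
  | nil => rfl
  | cons x l ih =>
    have hx : (l.map f).toFinset.filter (R (f x)) = (l.toFinset.filter (S x)).image f := by
      ext y
      simp only [Finset.mem_filter, List.mem_toFinset, List.mem_map, Finset.mem_image]
      constructor
      · rintro ⟨⟨z, hz, rfl⟩, hr⟩
        exact ⟨z, ⟨hz, (h x (by simp) z (by simp [hz])).1 hr⟩, rfl⟩
      · rintro ⟨z, ⟨hz, hs⟩, rfl⟩
        exact ⟨⟨z, hz, rfl⟩, (h x (by simp) z (by simp [hz])).2 hs⟩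
    rw [List.map_cons, rightCount, rightCount, hx, Finset.card_image_of_injOn, ih]
    · exact hf.mono fun y hy => List.mem_cons_of_mem _ hy
    · exact fun y hy z hz => h y (by simp [hy]) z (by simp [hz])
    · refine hf.mono fun y hy => ?_
      simp only [Finset.coe_filter, List.mem_toFinset, Set.mem_ofPred_eq] at hy
      simp [hy.1]

theorem rightCount_replicate (hR : ∀ x, ¬ R x x) (t a : ℕ) :
    rightCount R (List.replicate t a) = 0 := by
  induction t with
  | zero => rfl
  | succ t ih =>
    rw [List.replicate_succ, rightCount, ih, add_zero, Finset.card_eq_zero,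
      Finset.filter_eq_empty_iff]
    intro y hy
    rw [List.mem_toFinset] at hy
    rw [List.eq_of_mem_replicate hy]
    exact hR a

theorem rightCount_map_add (l : List ℕ) (c : ℕ) (h : ∀ x y, R (x + c) (y + c) ↔ R x y) :
    rightCount R (l.map (· + c)) = rightCount R l :=
  rightCount_map (fun _ _ _ _ hxy => Nat.add_right_cancel hxy) fun x _ y _ => h x y

end rightCount

namespace WachsWhite

theorem rb_eq_rightCount {n : ℕ} (w : Fin n → ℕ) : rb w = rightCount (· < ·) (List.ofFn w) := by
  rw [rightCount_ofFn]
  rfl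

theorem rs_eq_rightCount {n : ℕ} (w : Fin n → ℕ) : rs w = rightCount (· > ·) (List.ofFn w) := by
  rw [rightCount_ofFn]
  rfl

theorem image_lt_rev {n : ℕ} (w : Fin n → ℕ) (i : Fin n) :
    (Finset.univ.filter (fun j => i < j)).image (w ∘ Fin.rev)
      = (Finset.univ.filter (fun j => j < i.rev)).image w := by
  ext v
  simp only [Finset.mem_image, Finset.mem_filter, Finset.mem_univ, true_and, Function.comp]
  constructor
  · rintro ⟨j, hj, rfl⟩
    exact ⟨j.rev, by simpa using hj, rfl⟩
  · rintro ⟨j, hj, rfl⟩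
    exact ⟨j.rev, by rw [← Fin.rev_lt_rev]; simpa using hj, by simp⟩

theorem reverse_ofFn {n : ℕ} (w : Fin n → ℕ) :
    (List.ofFn w).reverse = List.ofFn (w ∘ Fin.rev) := by
  refine List.ext_getElem (by simp) fun i h1 h2 => ?_
  simp only [List.getElem_reverse, List.getElem_ofFn, Function.comp, List.length_ofFn]
  congr 1
  ext
  simp only [Fin.val_rev]
  omega

theorem ls_eq_rightCount {n : ℕ} (w : Fin n → ℕ) :
    ls w = rightCount (· > ·) (List.ofFn w).reverse := by
  rw [reverse_ofFn, rightCount_ofFn]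
  refine (Equiv.sum_comp Fin.revPerm _).symm.trans (Finset.sum_congr rfl fun i _ => ?_)
  rw [image_lt_rev]
  rfl

theorem lb_eq_rightCount {n : ℕ} (w : Fin n → ℕ) :
    lb w = rightCount (· < ·) (List.ofFn w).reverse := by
  rw [reverse_ofFn, rightCount_ofFn]
  refine (Equiv.sum_comp Fin.revPerm _).symm.trans (Finset.sum_congr rfl fun i _ => ?_)
  rw [image_lt_rev]
  rfl

end WachsWhite

/-- Restricted growth functions as lists: the letters are positive, and every positive letter smaller
than the one in position `i` occurs to the left of it. -/
def IsRGF (l : List ℕ) : Prop :=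
  ∀ (i : ℕ) (h : i < l.length), 1 ≤ l[i] ∧ ∀ v, 1 ≤ v → v < l[i] → v ∈ l.take i

theorem isRestrictedGrowth_iff {n : ℕ} (w : Fin n → ℕ) :
    IsRestrictedGrowth w ↔ IsRGF (List.ofFn w) := by
  have key : ∀ (i : ℕ) (h : i < n) (v : ℕ),
      v ∈ (List.ofFn w).take i ↔ ∃ j < (⟨i, h⟩ : Fin n), w j = v := by
    intro i h v
    rw [List.mem_take_iff_getElem]
    constructor
    · rintro ⟨j, hj, rfl⟩
      simp only [List.length_ofFn, lt_min_iff] at hj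
      exact ⟨⟨j, hj.2⟩, hj.1, by simp⟩
    · rintro ⟨j, hj, rfl⟩
      exact ⟨j, by simpa [Fin.lt_def] using hj, by simp⟩
  constructor
  · intro hw i h
    rw [List.length_ofFn] at h
    simpa only [List.getElem_ofFn, key i h] using hw ⟨i, h⟩
  · intro hw i
    have := hw i (by simp)
    simpa only [List.getElem_ofFn, key i i.2] using this

theorem exists_orderEmbedding_iff_sublist {n k : ℕ} (w : Fin n → ℕ) (p : (Fin k → ℕ) → Prop) :
    (∃ f : Fin k ↪o Fin n, p (w ∘ f)) ↔ ∃ u : Fin k → ℕ, (List.ofFn u).Sublist (List.ofFn w) ∧ p u := by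
  have hn : (List.ofFn w).length = n := List.length_ofFn
  constructor
  · rintro ⟨f, hf⟩
    refine ⟨w ∘ f, ?_, hf⟩
    have hk : (List.ofFn (w ∘ f)).length = k := List.length_ofFn
    rw [List.sublist_iff_exists_fin_orderEmbedding_get_eq]
    refine ⟨((Fin.castOrderIso hk).toOrderEmbedding.trans f).trans
      (Fin.castOrderIso hn.symm).toOrderEmbedding, fun i => ?_⟩
    simp only [List.get_ofFn]
    rfl
  · rintro ⟨u, hu, hp⟩
    have hk : (List.ofFn u).length = k := List.length_ofFn
    rw [List.sublist_iff_exists_fin_orderEmbedding_get_eq] at hu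
    obtain ⟨f, hf⟩ := hu
    refine ⟨((Fin.castOrderIso hk.symm).toOrderEmbedding.trans f).trans
      (Fin.castOrderIso hn).toOrderEmbedding, ?_⟩
    convert hp using 1
    funext i
    have := hf (Fin.cast hk.symm i)
    simp only [List.get_ofFn] at this
    simpa using this.symm

/-- The word has no subword `x y x z` with `x`, `y`, `z` distinct, in any order of size; these
subwords are the copies of `13/2/4`. -/
def Avoids1213 (l : List ℕ) : Prop :=
  ∀ x y z, [x, y, x, z].Sublist l → y = x ∨ z = x ∨ z = y

/-- The word has no subword `z x y x` with `x`, `y`, `z` distinct, in any order of size; these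
subwords are the copies of `1/24/3`. -/
def Avoids1232 (l : List ℕ) : Prop :=
  ∀ x y z, [z, x, y, x].Sublist l → y = x ∨ z = x ∨ z = y

theorem mem_avoidanceWords_13_2_4_iff {n : ℕ} (w : Fin n → ℕ) :
    w ∈ avoidanceWords n SetPartition.pattern13_2_4 ↔
      IsRGF (List.ofFn w) ∧ Avoids1213 (List.ofFn w) := by
  rw [mem_avoidanceWords_iff, isRestrictedGrowth_iff]
  have key : ∀ i j : Fin 4, (SetPartition.pattern13_2_4.part (i + 1) =
      SetPartition.pattern13_2_4.part (j + 1)) ↔ (![1, 2, 1, 3] : Fin 4 → ℕ) i = ![1, 2, 1, 3] j := by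
    decide
  simp only [key]
  refine and_congr_right fun _ => ?_
  refine (not_congr (exists_orderEmbedding_iff_sublist w
    (fun u : Fin 4 → ℕ => ∀ i j, u i = u j ↔ (![1, 2, 1, 3] : Fin 4 → ℕ) i = ![1, 2, 1, 3] j))).trans ?_
  constructor
  · intro h x y z hs
    by_contra! hne
    refine h ⟨![x, y, x, z], by simpa using hs, ?_⟩
    simp [Fin.forall_fin_succ, hne, hne.1.symm, hne.2.1.symm, hne.2.2.symm]
  · rintro h ⟨u, hs, hu⟩
    have e : List.ofFn u = [u 0, u 1, u 0, u 3] := by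
      have : u 2 = u 0 := by simp [hu]
      simp [List.ofFn_succ, ← this]
    rw [e] at hs
    rcases h _ _ _ hs with h | h | h <;> simp [hu] at h

theorem mem_avoidanceWords_1_24_3_iff {n : ℕ} (w : Fin n → ℕ) :
    w ∈ avoidanceWords n SetPartition.pattern1_24_3 ↔
      IsRGF (List.ofFn w) ∧ Avoids1232 (List.ofFn w) := by
  rw [mem_avoidanceWords_iff, isRestrictedGrowth_iff]
  have key : ∀ i j : Fin 4, (SetPartition.pattern1_24_3.part (i + 1) =
      SetPartition.pattern1_24_3.part (j + 1)) ↔ (![1, 2, 3, 2] : Fin 4 → ℕ) i = ![1, 2, 3, 2] j := by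
    decide
  simp only [key]
  refine and_congr_right fun _ => ?_
  refine (not_congr (exists_orderEmbedding_iff_sublist w
    (fun u : Fin 4 → ℕ => ∀ i j, u i = u j ↔ (![1, 2, 3, 2] : Fin 4 → ℕ) i = ![1, 2, 3, 2] j))).trans ?_
  constructor
  · intro h x y z hs
    by_contra! hne
    refine h ⟨![z, x, y, x], by simpa using hs, ?_⟩
    simp [Fin.forall_fin_succ, hne, hne.1.symm, hne.2.1.symm, hne.2.2.symm]
  · rintro h ⟨u, hs, hu⟩
    have e : List.ofFn u = [u 0, u 1, u 2, u 1] := by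
      have : u 3 = u 1 := by simp [hu]
      simp [List.ofFn_succ, ← this]
    rw [e] at hs
    rcases h _ _ _ hs with h | h | h <;> simp [hu] at h

/-! ### Layered words and cores -/

/-- The letters of `l` are exactly `1, …, m`. -/
def HasLetters (m : ℕ) (l : List ℕ) : Prop := ∀ x, x ∈ l ↔ 1 ≤ x ∧ x ≤ m

/-- The weakly increasing words `1 ⋯ 1 2 ⋯ 2 ⋯ m ⋯ m` in which each of `1, …, m` occurs. -/
def IsLayered (m : ℕ) (l : List ℕ) : Prop := l.Pairwise (· ≤ ·) ∧ HasLetters m l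

/-- The pair `(c, t)` represents the word `c 1ᵗ` with letters `1, …, s`, where `c` is the part of it
up to the last occurrence of `s ≥ 2`. The word is required to start with `1` and to be either binary
or of the form `1 ⋯ 1 2 ⋯ 2 ⋯ s ⋯ s 1 ⋯ 1`, and not to be weakly increasing. -/
structure IsCore (s : ℕ) (c : List ℕ) (t : ℕ) : Prop where
  two_le : 2 ≤ s
  letters : HasLetters s c
  head : c.head? = some 1
  last : c.getLast? = some s
  two_or_sorted : s = 2 ∨ c.Pairwise (· ≤ ·)
  not_sorted : t = 0 → ¬ c.Pairwise (· ≤ ·)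

/-- The word `c 1ᵗ` is a core, or empty. -/
def IsCoreOrEmpty (s : ℕ) (c : List ℕ) (t : ℕ) : Prop := (s = 0 ∧ c = [] ∧ t = 0) ∨ IsCore s c t

/-- The word `c 1ᵗ`. -/
def coreWord (c : List ℕ) (t : ℕ) : List ℕ := c ++ List.replicate t 1

/-- The word `P` followed by the word `Q`, the letters of the latter being raised by `m`. When
`1, …, m` are the letters of `P` this is the direct sum of the words. -/
def shiftAppend (m : ℕ) (P Q : List ℕ) : List ℕ := P ++ Q.map (· + m)

theorem HasLetters.unique {m m' : ℕ} {l : List ℕ} (h : HasLetters m l) (h' : HasLetters m' l) :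
    m = m' := by
  have h1 := (h m).symm.trans (h' m)
  have h2 := (h m').symm.trans (h' m')
  omega

theorem HasLetters.shiftAppend {a b : ℕ} {P Q : List ℕ} (hP : HasLetters a P)
    (hQ : HasLetters b Q) : HasLetters (a + b) (shiftAppend a P Q) := by
  intro x
  simp only [_root_.shiftAppend, List.mem_append, List.mem_map, hP x, hQ _]
  constructor
  · rintro (h | ⟨y, hy, rfl⟩) <;> omega
  · intro h
    by_cases hx : x ≤ a
    · exact Or.inl ⟨h.1, hx⟩
    · exact Or.inr ⟨x - a, by omega, by omega⟩

theorem HasLetters.snoc_of_mem {m d : ℕ} {l : List ℕ} (h : HasLetters m l) (hd : d ∈ l) :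
    HasLetters m (l ++ [d]) := by
  intro x
  simp only [List.mem_append, List.mem_singleton, ← h x]
  exact ⟨fun hx => hx.elim id fun e => e ▸ hd, Or.inl⟩

theorem HasLetters.snoc_succ {m : ℕ} {l : List ℕ} (h : HasLetters m l) :
    HasLetters (m + 1) (l ++ [m + 1]) := by
  intro x
  simp only [List.mem_append, List.mem_singleton, h x]
  omega

theorem isLayered_nil : IsLayered 0 [] := ⟨List.Pairwise.nil, fun x => by simp; omega⟩

theorem IsLayered.snoc_succ {m : ℕ} {l : List ℕ} (h : IsLayered m l) :
    IsLayered (m + 1) (l ++ [m + 1]) := by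
  refine ⟨?_, h.2.snoc_succ⟩
  rw [List.pairwise_append]
  refine ⟨h.1, by simp, fun a ha b hb => ?_⟩
  rw [List.mem_singleton.1 hb]
  exact ((h.2 a).1 ha).2.trans (Nat.le_succ m)

theorem IsLayered.snoc {m : ℕ} {l : List ℕ} (h : IsLayered m l) (hm : 1 ≤ m) :
    IsLayered m (l ++ [m]) := by
  refine ⟨?_, h.2.snoc_of_mem ((h.2 m).2 ⟨hm, le_rfl⟩)⟩
  rw [List.pairwise_append]
  refine ⟨h.1, by simp, fun a ha b hb => ?_⟩
  rw [List.mem_singleton.1 hb]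
  exact ((h.2 a).1 ha).2

theorem IsLayered.head? {m : ℕ} {l : List ℕ} (h : IsLayered m l) (hm : 1 ≤ m) :
    l.head? = some 1 := by
  have h1 : 1 ∈ l := (h.2 1).2 ⟨le_rfl, hm⟩
  obtain _ | ⟨x, l⟩ := l
  · simp at h1
  · have hx := ((h.2 x).1 (by simp)).1
    rcases List.mem_cons.1 h1 with rfl | h1
    · rfl
    · have := (List.pairwise_cons.1 h.1).1 1 h1
      simp only [List.head?_cons, Option.some.injEq]
      omega

theorem IsLayered.getLast? {m : ℕ} {l : List ℕ} (h : IsLayered m l) (hm : 1 ≤ m) :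
    l.getLast? = some m := by
  have h1 : m ∈ l := (h.2 m).2 ⟨hm, le_rfl⟩
  rcases List.eq_nil_or_concat' l with rfl | ⟨l, x, rfl⟩
  · simp at h1
  · have hx := ((h.2 x).1 (by simp)).2
    rcases List.mem_append.1 h1 with h1 | h1
    · have := (List.pairwise_append.1 h.1).2.2 m h1 x (by simp)
      simp only [List.getLast?_append, List.getLast?_singleton, Option.some_or, Option.some.injEq]
      omega
    · simp [List.mem_singleton.1 h1]

theorem IsLayered.isCore {m : ℕ} {l : List ℕ} (h : IsLayered m l) (hm : 2 ≤ m) : IsCore m l 1 where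
  two_le := hm
  letters := h.2
  head := h.head? (by omega)
  last := h.getLast? (by omega)
  two_or_sorted := Or.inr h.1
  not_sorted := by simp

theorem pairwise_le_eq_filter_append {l : List ℕ} (h : l.Pairwise (· ≤ ·)) (d : ℕ) :
    l = l.filter (· ≤ d) ++ l.filter (d < ·) := by
  induction l with
  | nil => rfl
  | cons x l ih =>
    rw [List.pairwise_cons] at h
    by_cases hx : x ≤ d
    · conv_lhs => rw [ih h.2]
      simp [hx]
    · have h1 : l.filter (· ≤ d) = [] := by
        rw [List.filter_eq_nil_iff]
        intro y hy
        have := h.1 y hy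
        simp only [decide_eq_true_eq]
        omega
      have h2 : l.filter (d < ·) = l := by
        rw [List.filter_eq_self]
        intro y hy
        have := h.1 y hy
        simp only [decide_eq_true_eq]
        omega
      simp [h1, h2, hx, not_le.1 hx]

/-- A layered word is the direct sum of its subword of letters at most `d` and a layered word. -/
theorem IsLayered.exists_eq_shiftAppend {m d : ℕ} {l : List ℕ} (h : IsLayered m l) (hd : d ≤ m) :
    ∃ P Q, IsLayered d P ∧ IsLayered (m - d) Q ∧ l = shiftAppend d P Q := by
  refine ⟨l.filter (· ≤ d), (l.filter (d < ·)).map (· - d), ⟨h.1.filter _, ?_⟩, ⟨?_, ?_⟩, ?_⟩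
  · intro x
    simp only [List.mem_filter, h.2 x, decide_eq_true_eq]
    omega
  · exact (h.1.filter _).map _ fun a b hab => Nat.sub_le_sub_right hab d
  · intro x
    simp only [List.mem_map, List.mem_filter, h.2 _, decide_eq_true_eq]
    constructor
    · rintro ⟨y, hy, rfl⟩
      omega
    · intro hx
      exact ⟨x + d, by omega, by omega⟩
  · conv_lhs => rw [pairwise_le_eq_filter_append h.1 d]
    rw [shiftAppend, List.map_map]
    congr 1
    conv_lhs => rw [← List.map_id (l.filter (d < ·))]
    refine List.map_congr_left fun x hx => ?_
    simp only [List.mem_filter, decide_eq_true_eq] at hx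
    simp only [id, Function.comp]
    omega

theorem mem_coreWord {c : List ℕ} {t x : ℕ} : x ∈ coreWord c t ↔ x ∈ c ∨ (t ≠ 0 ∧ x = 1) := by
  simp [coreWord]

theorem coreWord_succ (c : List ℕ) (t : ℕ) : coreWord c (t + 1) = coreWord c t ++ [1] := by
  simp [coreWord, List.replicate_succ']

theorem IsCore.hasLetters_coreWord {s t : ℕ} {c : List ℕ} (h : IsCore s c t) :
    HasLetters s (coreWord c t) := by
  intro x
  have := h.two_le
  rw [mem_coreWord, h.letters x]
  omega

theorem IsCoreOrEmpty.hasLetters {s t : ℕ} {c : List ℕ} (h : IsCoreOrEmpty s c t) :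
    HasLetters s c := by
  rcases h with ⟨rfl, rfl, rfl⟩ | h
  · exact isLayered_nil.2
  · exact h.letters

theorem IsCoreOrEmpty.hasLetters_coreWord {s t : ℕ} {c : List ℕ} (h : IsCoreOrEmpty s c t) :
    HasLetters s (coreWord c t) := by
  rcases h with ⟨rfl, rfl, rfl⟩ | h
  · exact isLayered_nil.2
  · exact h.hasLetters_coreWord

theorem IsCore.exists_eq_cons {s t : ℕ} {c : List ℕ} (h : IsCore s c t) :
    ∃ c', c = 1 :: (c' ++ [s]) := by
  have h1 := h.head
  have h2 := h.last
  have h3 := h.two_le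
  obtain _ | ⟨x, c⟩ := c
  · simp at h1
  · rcases List.eq_nil_or_concat' c with rfl | ⟨c, y, rfl⟩
    · simp only [List.head?_cons, List.getLast?_singleton, Option.some.injEq] at h1 h2
      omega
    · rw [← List.cons_append] at h2
      simp only [List.head?_cons, List.getLast?_append, List.getLast?_singleton,
        Option.some_or, Option.some.injEq] at h1 h2
      exact ⟨c, by simp [h1, h2]⟩

theorem IsCore.succ {s t : ℕ} {c : List ℕ} (h : IsCore s c t) : IsCore s c (t + 1) :=
  ⟨h.two_le, h.letters, h.head, h.last, h.two_or_sorted, by simp⟩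

/-- A core contains a letter `y > 1` to the left of a letter `1`. -/
theorem IsCore.exists_descent {s t : ℕ} {c : List ℕ} (h : IsCore s c t) :
    ∃ y, 1 < y ∧ y ≤ s ∧ [y, 1].Sublist (coreWord c t) := by
  have hs := h.two_le
  obtain _ | t := t
  · have hn := h.not_sorted rfl
    have h2 : s = 2 := h.two_or_sorted.resolve_right hn
    simp only [List.pairwise_iff_forall_sublist, not_forall, not_le] at hn
    obtain ⟨a, b, hab, hlt⟩ := hn
    have ha := (h.letters a).1 (hab.subset (by simp))
    have hb := (h.letters b).1 (hab.subset (by simp))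
    have hb1 : b = 1 := by omega
    exact ⟨a, by omega, by omega, by simpa [coreWord, ← hb1] using hab⟩
  · refine ⟨s, by omega, le_rfl, ?_⟩
    rw [coreWord_succ]
    have : s ∈ coreWord c t := mem_coreWord.2 (Or.inl ((h.letters s).2 ⟨by omega, le_rfl⟩))
    exact (List.singleton_sublist.2 this).append (List.Sublist.refl [1])

theorem IsCore.snoc_two {t : ℕ} {c : List ℕ} (h : IsCore 2 c t) :
    IsCore 2 (coreWord c t ++ [2]) 0 where
  two_le := le_rfl
  letters := h.hasLetters_coreWord.snoc_of_mem ((h.hasLetters_coreWord 2).2 ⟨by simp, le_rfl⟩)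
  head := by simp [coreWord, h.head]
  last := by simp
  two_or_sorted := Or.inl rfl
  not_sorted := by
    intro _ hs
    obtain ⟨y, hy, -, hsub⟩ := h.exists_descent
    have := List.pairwise_iff_forall_sublist.1 hs (hsub.trans (List.sublist_append_left _ _))
    omega

/-! ### Restricted growth of the direct sums -/

theorem IsRGF.of_snoc {l : List ℕ} {d : ℕ} (h : IsRGF (l ++ [d])) : IsRGF l := by
  intro i hi
  have := h i (by simp; omega)
  rwa [List.getElem_append_left hi, List.take_append_of_le_length hi.le] at this

theorem IsRGF.snoc_bounds {l : List ℕ} {d m : ℕ} (h : IsRGF (l ++ [d])) (hl : HasLetters m l) :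
    1 ≤ d ∧ d ≤ m + 1 := by
  have h1 := h l.length (by simp)
  simp only [List.getElem_concat_length, List.take_left'] at h1
  refine ⟨h1.1, ?_⟩
  by_contra! hd
  have := (hl (m + 1)).1 (h1.2 (m + 1) (by omega) hd)
  omega

theorem IsLayered.isRGF {m : ℕ} {l : List ℕ} (h : IsLayered m l) : IsRGF l := by
  intro i hi
  have hli := (h.2 l[i]).1 (List.getElem_mem hi)
  refine ⟨hli.1, fun v hv hvi => ?_⟩
  obtain ⟨j, hj, rfl⟩ := List.getElem_of_mem ((h.2 v).2 ⟨hv, by omega⟩)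
  rw [List.mem_take_iff_getElem]
  refine ⟨j, ?_, rfl⟩
  by_contra hji
  have hij : i < j := by
    rcases lt_trichotomy i j with h' | rfl | h'
    · exact h'
    · omega
    · omega
  have := List.pairwise_iff_getElem.1 h.1 i j hi hj hij
  omega

theorem IsRGF.append_of_forall_eq_one {P Q : List ℕ} (hP : IsRGF P) (hQ : ∀ q ∈ Q, q = 1) :
    IsRGF (P ++ Q) := by
  intro i hi
  by_cases hiP : i < P.length
  · rw [List.getElem_append_left hiP, List.take_append_of_le_length hiP.le]
    exact hP i hiP
  · rw [List.getElem_append_right (not_lt.1 hiP), hQ _ (List.getElem_mem _)]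
    exact ⟨le_rfl, fun v hv hv1 => by omega⟩

theorem IsRGF.shiftAppend {m : ℕ} {P Q : List ℕ} (hP : IsRGF P) (hPm : HasLetters m P)
    (hQ : IsRGF Q) : IsRGF (shiftAppend m P Q) := by
  intro i hi
  simp only [_root_.shiftAppend, List.length_append, List.length_map] at hi ⊢
  by_cases hiP : i < P.length
  · rw [List.getElem_append_left hiP, List.take_append_of_le_length hiP.le]
    exact hP i hiP
  · obtain ⟨k, rfl⟩ := Nat.exists_eq_add_of_le (not_lt.1 hiP)
    have hk := hQ k (by omega)
    rw [List.getElem_append_right (Nat.le_add_right _ _), List.take_length_add_append]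
    simp only [Nat.add_sub_cancel_left, List.getElem_map]
    refine ⟨by omega, fun v hv hvk => ?_⟩
    rw [List.mem_append]
    by_cases hvm : v ≤ m
    · exact Or.inl ((hPm v).2 ⟨hv, hvm⟩)
    · refine Or.inr ?_
      rw [← List.map_take, List.mem_map]
      exact ⟨v - m, hk.2 _ (by omega) (by omega), by omega⟩

theorem IsCore.isRGF {s t : ℕ} {c : List ℕ} (h : IsCore s c t) : IsRGF (coreWord c t) := by
  refine IsRGF.append_of_forall_eq_one ?_ fun q hq => List.eq_of_mem_replicate hq
  rcases h.two_or_sorted with rfl | hs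
  · intro i hi
    have hci := (h.letters _).1 (List.getElem_mem hi)
    refine ⟨hci.1, fun v hv hvi => ?_⟩
    obtain ⟨c', rfl⟩ := h.exists_eq_cons
    have hv1 : v = 1 := by omega
    obtain _ | i := i
    · simp at hvi; omega
    · simp [hv1]
  · exact IsLayered.isRGF ⟨hs, h.letters⟩

theorem IsCoreOrEmpty.isRGF {s t : ℕ} {c : List ℕ} (h : IsCoreOrEmpty s c t) :
    IsRGF (coreWord c t) := by
  rcases h with ⟨rfl, rfl, rfl⟩ | h
  · exact isLayered_nil.isRGF
  · exact h.isRGF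

/-! ### The direct sums avoid the patterns -/

theorem eq_of_sublist_of_pairwise_le {l : List ℕ} (h : l.Pairwise (· ≤ ·)) {x y : ℕ}
    (hs : [x, y, x].Sublist l) : y = x := by
  have := h.sublist hs
  simp only [List.pairwise_cons, List.mem_cons, List.not_mem_nil, or_false, forall_eq_or_imp,
    forall_eq] at this
  omega

/-- A copy of a word of length four in a concatenation splits into a copy of an initial segment in
the left part and a copy of the complementary final segment in the right part. -/
theorem sublist_four_append {a b c d : ℕ} {P Q : List ℕ} (h : [a, b, c, d].Sublist (P ++ Q)) :
    [a, b, c, d].Sublist Q ∨ (a ∈ P ∧ [b, c, d].Sublist Q) ∨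
      ([a, b].Sublist P ∧ [c, d].Sublist Q) ∨ ([a, b, c].Sublist P ∧ d ∈ Q) ∨
      [a, b, c, d].Sublist P := by
  obtain ⟨l₁, l₂, he, h₁, h₂⟩ := List.sublist_append_iff.1 h
  rcases l₁ with _ | ⟨w, _ | ⟨x, _ | ⟨y, _ | ⟨z, l⟩⟩⟩⟩ <;>
    simp only [List.nil_append, List.cons_append, List.cons.injEq, List.nil_eq,
      List.append_eq_nil_iff] at he
  · subst he
    exact Or.inl h₂
  · obtain ⟨rfl, rfl⟩ := he
    exact Or.inr (Or.inl ⟨h₁.subset (by simp), h₂⟩)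
  · obtain ⟨rfl, rfl, rfl⟩ := he
    exact Or.inr (Or.inr (Or.inl ⟨h₁, h₂⟩))
  · obtain ⟨rfl, rfl, rfl, rfl⟩ := he
    exact Or.inr (Or.inr (Or.inr (Or.inl ⟨h₁, h₂.subset (by simp)⟩)))
  · obtain ⟨rfl, rfl, rfl, rfl, rfl, rfl⟩ := he
    exact Or.inr (Or.inr (Or.inr (Or.inr h₁)))

theorem Avoids1213.map_add {l : List ℕ} (h : Avoids1213 l) (m : ℕ) :
    Avoids1213 (l.map (· + m)) := by
  intro x y z hs
  obtain ⟨l', hl', he⟩ := List.sublist_map_iff.1 hs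
  rcases l' with _ | ⟨a, _ | ⟨b, _ | ⟨c, _ | ⟨d, _ | ⟨e, l⟩⟩⟩⟩⟩ <;> simp at he
  obtain ⟨rfl, rfl, hc, rfl⟩ := he
  have hca : c = a := by omega
  have := h a b d (hca ▸ hl')
  omega

theorem IsCoreOrEmpty.avoids1213 {s t : ℕ} {c : List ℕ} (h : IsCoreOrEmpty s c t) :
    Avoids1213 (coreWord c t) := by
  intro x y z hs
  rcases h with ⟨rfl, rfl, rfl⟩ | h
  · simp [coreWord] at hs
  rcases h.two_or_sorted with rfl | hc
  · have hm : ∀ v ∈ [x, y, x, z], 1 ≤ v ∧ v ≤ 2 := fun v hv =>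
      (h.hasLetters_coreWord v).1 (hs.subset hv)
    simp only [List.mem_cons, List.not_mem_nil, or_false, forall_eq_or_imp, forall_eq] at hm
    omega
  · have h1 : ∀ {l : List ℕ} {v : ℕ}, l.Sublist (List.replicate t 1) → v ∈ l → v = 1 :=
      fun hl hv => List.eq_of_mem_replicate (hl.subset hv)
    rcases sublist_four_append hs with hs | ⟨-, hs⟩ | ⟨-, hs⟩ | ⟨hs, -⟩ | hs
    · exact Or.inl ((h1 hs (by simp)).trans (h1 hs (by simp)).symm)
    · exact Or.inl ((h1 hs (by simp)).trans (h1 hs (by simp)).symm)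
    · exact Or.inr (Or.inl ((h1 hs (by simp)).trans (h1 hs (by simp)).symm))
    · exact Or.inl (eq_of_sublist_of_pairwise_le hc hs)
    · exact Or.inl (eq_of_sublist_of_pairwise_le hc
        ((List.sublist_append_left [x, y, x] [z]).trans hs))

theorem IsCoreOrEmpty.avoids1232 {s t : ℕ} {c : List ℕ} (h : IsCoreOrEmpty s c t) :
    Avoids1232 (coreWord c t) := by
  intro x y z hs
  rcases h with ⟨rfl, rfl, rfl⟩ | h
  · simp [coreWord] at hs
  rcases h.two_or_sorted with rfl | hc
  · have hm : ∀ v ∈ [z, x, y, x], 1 ≤ v ∧ v ≤ 2 := fun v hv =>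
      (h.hasLetters_coreWord v).1 (hs.subset hv)
    simp only [List.mem_cons, List.not_mem_nil, or_false, forall_eq_or_imp, forall_eq] at hm
    omega
  · have h1 : ∀ {l : List ℕ} {v : ℕ}, l.Sublist (List.replicate t 1) → v ∈ l → v = 1 :=
      fun hl hv => List.eq_of_mem_replicate (hl.subset hv)
    rcases sublist_four_append hs with hs | ⟨-, hs⟩ | ⟨-, hs⟩ | ⟨hs, hx⟩ | hs
    · exact Or.inl ((h1 hs (by simp)).trans (h1 hs (by simp)).symm)
    · exact Or.inl ((h1 hs (by simp)).trans (h1 hs (by simp)).symm)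
    · exact Or.inl ((h1 hs (by simp)).trans (h1 hs (by simp)).symm)
    · have hx1 := List.eq_of_mem_replicate hx
      have hz := (h.letters z).1 (hs.subset (by simp))
      have := hc.sublist hs
      simp only [List.pairwise_cons, List.mem_cons, List.not_mem_nil, or_false,
        forall_eq_or_imp, forall_eq] at this
      omega
    · exact Or.inl (eq_of_sublist_of_pairwise_le hc ((List.sublist_cons_self z [x, y, x]).trans hs))

theorem lt_of_mem_map_add {n s x : ℕ} {l : List ℕ} (h : HasLetters n l)
    (hx : x ∈ l.map (· + s)) : s < x := by
  obtain ⟨y, hy, rfl⟩ := List.mem_map.1 hx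
  have := (h y).1 hy
  omega

theorem Avoids1213.shiftAppend {r s : ℕ} {P Q : List ℕ} (hP : IsLayered r P)
    (hs : HasLetters s Q) (hQ : Avoids1213 Q) : Avoids1213 (shiftAppend r P Q) := by
  intro x y z h
  have hlt : ∀ {v}, v ∈ P → v ∈ Q.map (· + r) → False := fun h1 h2 =>
    absurd ((hP.2 _).1 h1).2 (lt_of_mem_map_add hs h2).not_ge
  rcases sublist_four_append h with h | ⟨h1, h⟩ | ⟨h1, h⟩ | ⟨h, -⟩ | h
  · exact hQ.map_add r x y z h
  · exact (hlt h1 (h.subset (by simp))).elim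
  · exact (hlt (h1.subset (by simp)) (h.subset (by simp : x ∈ _))).elim
  · exact Or.inl (eq_of_sublist_of_pairwise_le hP.1 h)
  · exact Or.inl (eq_of_sublist_of_pairwise_le hP.1
      ((List.sublist_append_left [x, y, x] [z]).trans h))

theorem Avoids1232.shiftAppend {r s : ℕ} {P Q : List ℕ} (hP : IsLayered r P)
    (hs : HasLetters s Q) (hQ : Avoids1232 Q) : Avoids1232 (shiftAppend s Q P) := by
  intro x y z h
  have hlt : ∀ {v}, v ∈ Q → v ∈ P.map (· + s) → False := fun h1 h2 =>
    absurd ((hs _).1 h1).2 (lt_of_mem_map_add hP.2 h2).not_ge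
  have hsort : (P.map (· + s)).Pairwise (· ≤ ·) :=
    hP.1.map _ fun a b hab => Nat.add_le_add_right hab s
  rcases sublist_four_append h with h | ⟨-, h⟩ | ⟨h1, h⟩ | ⟨h1, h⟩ | h
  · exact Or.inl (eq_of_sublist_of_pairwise_le hsort
      ((List.sublist_cons_self z [x, y, x]).trans h))
  · exact Or.inl (eq_of_sublist_of_pairwise_le hsort h)
  · exact (hlt (h1.subset (by simp)) (h.subset (by simp : x ∈ _))).elim
  · exact (hlt (h1.subset (by simp)) h).elim
  · exact hQ x y z h

/-! ### Every avoiding word is a direct sum -/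

theorem sublist_pair_of_head? {l : List ℕ} {a b : ℕ} (ha : l.head? = some a) (hb : b ∈ l)
    (hne : b ≠ a) : [a, b].Sublist l := by
  obtain _ | ⟨x, l⟩ := l
  · simp at hb
  · simp only [List.head?_cons, Option.some.injEq] at ha
    subst ha
    exact (List.singleton_sublist.2 ((List.mem_cons.1 hb).resolve_left hne)).cons_cons x

theorem sublist_triple_of_head?_of_getLast? {l : List ℕ} {a b c : ℕ} (ha : l.head? = some a)
    (hc : l.getLast? = some c) (hb : b ∈ l) (hba : b ≠ a) (hbc : b ≠ c) :
    [a, b, c].Sublist l := by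
  rcases List.eq_nil_or_concat' l with rfl | ⟨l, y, rfl⟩
  · simp at hb
  · simp only [List.getLast?_append, List.getLast?_singleton, Option.some_or,
      Option.some.injEq] at hc
    subst hc
    have hbl : b ∈ l := by simpa [hbc] using hb
    refine (sublist_pair_of_head? ?_ hbl hba).append (List.Sublist.refl [y])
    rwa [List.head?_append_of_ne_nil _ (List.ne_nil_of_mem hbl)] at ha

theorem sublist_pair_of_pairwise_le {l : List ℕ} (h : l.Pairwise (· ≤ ·)) {a b : ℕ} (ha : a ∈ l)
    (hb : b ∈ l) (hab : a < b) : [a, b].Sublist l := by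
  obtain ⟨u, v, rfl⟩ := List.append_of_mem ha
  have hbv : b ∈ v := by
    rw [List.mem_append, List.mem_cons] at hb
    rcases hb with hb | rfl | hb
    · have := (List.pairwise_append.1 h).2.2 b hb a (by simp)
      omega
    · omega
    · exact hb
  exact ((List.singleton_sublist.2 hbv).cons_cons a).trans (List.sublist_append_right _ _)

theorem IsCore.head?_coreWord {s t : ℕ} {c : List ℕ} (h : IsCore s c t) :
    (coreWord c t).head? = some 1 := by
  simp [coreWord, h.head]

theorem exists_eq_shiftAppend_core_of_avoids1213 {l : List ℕ} (hl : IsRGF l) (ha : Avoids1213 l) :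
    ∃ r s P c t, IsLayered r P ∧ IsCoreOrEmpty s c t ∧ shiftAppend r P (coreWord c t) = l := by
  induction l using List.reverseRecOn with
  | nil => exact ⟨0, 0, [], [], 0, isLayered_nil, Or.inl ⟨rfl, rfl, rfl⟩, rfl⟩
  | append_singleton l d ih =>
    obtain ⟨r, s, P, c, t, hP, hc, rfl⟩ := ih hl.of_snoc fun x y z h =>
      ha x y z (h.trans (List.sublist_append_left _ _))
    have hb := hl.snoc_bounds (hP.2.shiftAppend hc.hasLetters_coreWord)
    rcases hc with ⟨rfl, rfl, rfl⟩ | hc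
    · simp only [shiftAppend, coreWord, List.replicate_zero, List.append_nil, List.map_nil]
      by_cases h1 : d = r + 1
      · exact ⟨r + 1, 0, P ++ [r + 1], [], 0, hP.snoc_succ, Or.inl ⟨rfl, rfl, rfl⟩, by simp [h1]⟩
      by_cases h2 : d = r
      · subst h2
        exact ⟨d, 0, P ++ [d], [], 0, hP.snoc hb.1, Or.inl ⟨rfl, rfl, rfl⟩, by simp⟩
      -- The letters of `P` from `d` on, together with the new `d`, form a core.
      obtain ⟨P₁, c, hP₁, hc, rfl⟩ := hP.exists_eq_shiftAppend (d := d - 1) (by omega)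
      refine ⟨d - 1, r - (d - 1), P₁, c, 1, hP₁, Or.inr (hc.isCore (by omega)), ?_⟩
      simp [shiftAppend, Nat.add_sub_cancel' hb.1]
    · by_cases h1 : d = r + 1 ∧ (s = 2 ∨ c.Pairwise (· ≤ ·))
      · refine ⟨r, s, P, c, t + 1, hP, Or.inr hc.succ, ?_⟩
        simp [shiftAppend, coreWord_succ, h1.1, add_comm]
      have h1' : d ≠ r + 1 := fun h => h1 ⟨h, hc.two_or_sorted⟩
      by_cases h2 : s = 2 ∧ d = r + 2
      · obtain ⟨rfl, rfl⟩ := h2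
        -- The new letter is the maximum of the core, so the final `1ᵗ` is absorbed.
        refine ⟨r, 2, P, _, 0, hP, Or.inr hc.snoc_two, ?_⟩
        simp [shiftAppend, coreWord, add_comm]
      -- Otherwise `d` completes a copy `1 y 1` inside the core to a copy of `13/2/4`.
      exfalso
      have key : ∃ y, 1 < y ∧ y + r ≠ d ∧ [1, y, 1].Sublist (coreWord c t) := by
        by_cases hs : s = 2
        · obtain ⟨y, hy, hys, hsub⟩ := hc.exists_descent
          refine ⟨y, hy, by omega, ?_⟩
          obtain ⟨q, hq⟩ : ∃ q, coreWord c t = 1 :: q := by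
            obtain ⟨c', rfl⟩ := hc.exists_eq_cons
            exact ⟨_, rfl⟩
          rw [hq] at hsub ⊢
          exact (hsub.of_cons_of_ne hy.ne').cons_cons 1
        · have hs2 := hc.two_le
          have ht : t ≠ 0 := fun ht => hc.not_sorted ht (hc.two_or_sorted.resolve_left hs)
          obtain ⟨t, rfl⟩ := Nat.exists_eq_succ_of_ne_zero ht
          have hmem : ∀ y, 1 < y → y ≤ s → [1, y, 1].Sublist (coreWord c (t + 1)) := by
            intro y hy hys
            rw [coreWord_succ]
            refine List.Sublist.append (l₁ := [1, y]) ?_ (List.Sublist.refl [1])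
            exact (sublist_pair_of_head? hc.head ((hc.letters y).2 ⟨hy.le, hys⟩) hy.ne').trans
              (List.sublist_append_left _ _)
          by_cases hd : 2 + r = d
          · exact ⟨3, by omega, by omega, hmem 3 (by omega) (by omega)⟩
          · exact ⟨2, by omega, hd, hmem 2 (by omega) (by omega)⟩
      obtain ⟨y, hy, hyd, hsub⟩ := key
      have := ha (1 + r) (y + r) d (((hsub.map (· + r)).trans
        (List.sublist_append_right P _)).append (List.Sublist.refl [d]))
      omega

theorem exists_eq_shiftAppend_layered_of_avoids1232 {l : List ℕ} (hl : IsRGF l) (ha : Avoids1232 l) :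
    ∃ r s P c t, IsLayered r P ∧ IsCoreOrEmpty s c t ∧ shiftAppend s (coreWord c t) P = l := by
  induction l using List.reverseRecOn with
  | nil => exact ⟨0, 0, [], [], 0, isLayered_nil, Or.inl ⟨rfl, rfl, rfl⟩, rfl⟩
  | append_singleton l d ih =>
    obtain ⟨r, s, P, c, t, hP, hc, rfl⟩ := ih hl.of_snoc fun x y z h =>
      ha x y z (h.trans (List.sublist_append_left _ _))
    have hlet := hc.hasLetters_coreWord.shiftAppend hP.2
    have hb := hl.snoc_bounds hlet
    by_cases h1 : d = s + r + 1
    · refine ⟨r + 1, s, P ++ [r + 1], c, t, hP.snoc_succ, hc, ?_⟩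
      simp [shiftAppend, h1]
      omega
    rcases Nat.eq_zero_or_pos r with rfl | hr
    · have hP0 : P = [] := List.eq_nil_iff_forall_not_mem.2 fun x hx => by
        have := (hP.2 x).1 hx
        omega
      subst hP0
      rcases hc with ⟨rfl, rfl, rfl⟩ | hc
      · omega
      simp only [shiftAppend, List.map_nil, List.append_nil] at ha ⊢
      by_cases h2 : d = 1
      · exact ⟨0, s, [], c, t + 1, hP, Or.inr hc.succ, by simp [coreWord_succ, h2]⟩
      by_cases h3 : s = 2
      · subst h3
        have : d = 2 := by omega
        subst this
        refine ⟨0, 2, [], _, 0, hP, Or.inr hc.snoc_two, by simp [coreWord]⟩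
      -- Now `c` is increasing, `s ≥ 3`, `t ≥ 1` and `2 ≤ d ≤ s`: either `2 d 1 d` or `1 d s d` is a
      -- copy of `1/24/3`.
      exfalso
      have hcs := hc.two_or_sorted.resolve_left h3
      have hs2 := hc.two_le
      have ht : t ≠ 0 := fun ht => hc.not_sorted ht hcs
      have hdc : d ∈ c := (hc.letters d).2 (by omega)
      by_cases h4 : d = s
      · have h2d := sublist_pair_of_pairwise_le hcs ((hc.letters 2).2 (by omega)) hdc (by omega)
        have h1t : [1].Sublist (List.replicate t 1) := by
          rw [List.singleton_sublist, List.mem_replicate]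
          exact ⟨ht, rfl⟩
        have := ha d 1 2 ((h2d.append h1t).append (List.Sublist.refl [d]))
        omega
      · have := ha d s 1 (((sublist_triple_of_head?_of_getLast? hc.head hc.last hdc h2 h4).trans
          (List.sublist_append_left _ _)).append (List.Sublist.refl [d]))
        omega
    · have hlast : (shiftAppend s (coreWord c t) P).getLast? = some (s + r) := by
        simp [shiftAppend, List.getLast?_append, hP.getLast? hr, add_comm]
      by_cases h2 : d = s + r
      · refine ⟨r, s, P ++ [r], c, t, hP.snoc hr, hc, ?_⟩
        simp [shiftAppend, h2]
        omega
      by_cases h3 : d = 1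
      · rcases hc with ⟨rfl, rfl, rfl⟩ | hc
        · refine ⟨0, r, [], P, 1, isLayered_nil, Or.inr (hP.isCore (by omega)), ?_⟩
          simp [shiftAppend, coreWord, h3]
        -- A descent `y 1` of the core gives the copy `y 1 m 1`, where `m = s + r` is the maximum.
        · exfalso
          obtain ⟨y, hy, hys, hsub⟩ := hc.exists_descent
          have hm : [s + r].Sublist (P.map (· + s)) := by
            rw [List.singleton_sublist, List.mem_map]
            exact ⟨r, (hP.2 r).2 ⟨hr, le_rfl⟩, add_comm _ _⟩
          have := ha 1 (s + r) y ((hsub.append hm).append (h3 ▸ List.Sublist.refl [d]))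
          omega
      -- The word starts with `1` and ends with its maximum `m = s + r`, which gives the copy
      -- `1 d m d`.
      · exfalso
        have hhead : (shiftAppend s (coreWord c t) P).head? = some 1 := by
          rcases hc with ⟨rfl, rfl, rfl⟩ | hc
          · simp [shiftAppend, coreWord, hP.head? hr]
          · simp [shiftAppend, hc.head?_coreWord]
        have hd : d ∈ shiftAppend s (coreWord c t) P := (hlet d).2 (by omega)
        have := ha d (s + r) 1 ((sublist_triple_of_head?_of_getLast? hhead hlast hd h3 h2).append
          (List.Sublist.refl [d]))
        omega

/-! ### Uniqueness of the decompositions -/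

theorem IsCoreOrEmpty.eq_of_coreWord_eq {s s' t t' : ℕ} {c c' : List ℕ}
    (h : IsCoreOrEmpty s c t) (h' : IsCoreOrEmpty s' c' t') (e : coreWord c t = coreWord c' t') :
    s = s' ∧ c = c' ∧ t = t' := by
  have hs : s = s' := h.hasLetters_coreWord.unique (e ▸ h'.hasLetters_coreWord)
  have aux : ∀ {t t' : ℕ} {c E : List ℕ}, IsCoreOrEmpty s (c ++ E) t → IsCoreOrEmpty s c t' →
      List.replicate t' 1 = E ++ List.replicate t 1 → E = [] := by
    intro t t' c E h h' e
    by_contra hE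
    rcases h with ⟨-, h, -⟩ | h
    · exact hE (List.append_eq_nil_iff.1 h).2
    · have h1 := h.last
      have h2 := h.two_le
      rw [List.getLast?_append_of_ne_nil _ hE] at h1
      have hmem : s ∈ List.replicate t' 1 := e ▸ List.mem_append_left _ (List.mem_of_getLast? h1)
      have := List.eq_of_mem_replicate hmem
      omega
  subst hs
  suffices hc : c = c' by
    subst hc
    simpa [coreWord] using e
  rcases List.append_eq_append_iff.1 e with ⟨E, rfl, hE⟩ | ⟨E, rfl, hE⟩
  · simp [aux h' h hE]
  · simp [aux h h' hE]

theorem eq_of_shiftAppend_core_eq {r r' s s' t t' : ℕ} {P P' c c' : List ℕ}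
    (hP : IsLayered r P) (hc : IsCoreOrEmpty s c t) (hP' : IsLayered r' P')
    (hc' : IsCoreOrEmpty s' c' t')
    (e : shiftAppend r P (coreWord c t) = shiftAppend r' P' (coreWord c' t')) :
    r = r' ∧ s = s' ∧ P = P' ∧ c = c' ∧ t = t' := by
  -- If `P` is a proper prefix of `P'`, then `P'` contains the least letter of the core behind `P`,
  -- hence all copies of it, and with them a descent of the core.
  have aux : ∀ {r r' s s' t t' : ℕ} {P E c c' : List ℕ}, IsLayered r P → IsCoreOrEmpty s c t →
      IsLayered r' (P ++ E) → IsCoreOrEmpty s' c' t' →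
      (coreWord c t).map (· + r) = E ++ (coreWord c' t').map (· + r') → E = [] := by
    intro r r' s s' t t' P E c c' hP hc hP' hc' e
    by_contra hE
    rcases hc with ⟨rfl, rfl, rfl⟩ | hc
    · simp [coreWord, hE] at e
    · obtain ⟨y, hy, -, hsub⟩ := hc.exists_descent
      have hhead := hc.head?_coreWord
      obtain ⟨x, E', rfl⟩ := List.exists_cons_of_ne_nil hE
      have hx : x = 1 + r := by
        have := congrArg List.head? e
        simpa [hhead] using this.symm
      have hxr : x ≤ r' := ((hP'.2 x).1 (by simp)).2
      have hsub' := hsub.map (· + r)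
      rw [e] at hsub'
      obtain ⟨l₁, l₂, hl, h₁, h₂⟩ := List.sublist_append_iff.1 hsub'
      rcases List.eq_nil_or_concat' l₂ with rfl | ⟨l₂, z, rfl⟩
      · rw [List.append_nil] at hl
        subst hl
        have := (List.pairwise_append.1 hP'.1).2.1.sublist h₁
        simp at this
        omega
      · rw [← List.append_assoc] at hl
        have hz : 1 + r = z := by
          have := congrArg List.getLast? hl
          simpa using this
        have := lt_of_mem_map_add hc'.hasLetters_coreWord (h₂.subset (by simp : z ∈ _))
        omega
  have hPP : P = P' := by
    rcases List.append_eq_append_iff.1 e with ⟨E, rfl, hE⟩ | ⟨E, rfl, hE⟩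
    · simp [aux hP hc hP' hc' hE]
    · simp [aux hP' hc' hP hc hE]
  subst hPP
  obtain rfl := hP.2.unique hP'.2
  have e' := List.append_cancel_left e
  have := hc.eq_of_coreWord_eq hc' (List.map_injective_iff.2 (add_left_injective r) e')
  exact ⟨rfl, this.1, rfl, this.2⟩

theorem eq_of_shiftAppend_layered_eq {r r' s s' t t' : ℕ} {P P' c c' : List ℕ}
    (hP : IsLayered r P) (hc : IsCoreOrEmpty s c t) (hP' : IsLayered r' P')
    (hc' : IsCoreOrEmpty s' c' t')
    (e : shiftAppend s (coreWord c t) P = shiftAppend s' (coreWord c' t') P') :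
    r = r' ∧ s = s' ∧ P = P' ∧ c = c' ∧ t = t' := by
  -- If the core `Q` is a proper prefix of the core `Q'`, then the rest of `Q'` is increasing with
  -- letters greater than those of `Q`. So `Q` is nonempty, and `Q'` has a letter greater than `2`
  -- and does not end with `1`.
  have aux : ∀ {r s s' t t' : ℕ} {P P₂ E c c' : List ℕ}, IsLayered r P → IsCoreOrEmpty s c t →
      IsCoreOrEmpty s' c' t' → coreWord c' t' = coreWord c t ++ E →
      P.map (· + s) = E ++ P₂ → E = [] := by
    intro r s s' t t' P P₂ E c c' hP hc hc' he e
    by_contra hE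
    have hEs : ∀ x ∈ E, s < x := fun x hx =>
      lt_of_mem_map_add hP.2 (e ▸ List.mem_append_left _ hx)
    rcases hc' with ⟨rfl, rfl, rfl⟩ | hc'
    · simp [coreWord, hE] at he
    rcases hc with ⟨rfl, rfl, rfl⟩ | hc
    · have hsort : (E ++ P₂).Pairwise (· ≤ ·) := by
        rw [← e]
        exact hP.1.map _ fun a b hab => Nat.add_le_add_right hab 0
      obtain ⟨y, hy, -, hsub⟩ := hc'.exists_descent
      rw [he] at hsub
      have := (List.pairwise_append.1 hsort).1.sublist hsub
      simp at this
      omega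
    · have hs := hc.two_le
      have hlast := List.getLast?_eq_some_getLast hE
      have hgt := hEs _ (List.getLast_mem hE)
      obtain _ | t' := t'
      · have h2 : s' = 2 := hc'.two_or_sorted.resolve_right (hc'.not_sorted rfl)
        have := (hc'.hasLetters_coreWord (E.getLast hE)).1 (he ▸ by simp)
        omega
      · rw [coreWord_succ] at he
        have := congrArg List.getLast? he
        rw [List.getLast?_append_of_ne_nil _ hE, hlast] at this
        simp at this
        omega
  have hQQ : coreWord c t = coreWord c' t' := by
    rcases List.append_eq_append_iff.1 e with ⟨E, h, hE⟩ | ⟨E, h, hE⟩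
    · simpa [aux hP hc hc' h hE] using h.symm
    · simpa [aux hP' hc' hc h hE] using h
  obtain ⟨rfl, rfl, rfl⟩ := hc.eq_of_coreWord_eq hc' hQQ
  have hPP := List.map_injective_iff.2 (add_left_injective s) (List.append_cancel_left e)
  subst hPP
  exact ⟨hP.2.unique hP'.2, rfl, rfl, rfl, rfl⟩

/-! ### Reverse complements -/

/-- The reverse complement of a word with letters in `1, …, m`. -/
def reverseComplement (m : ℕ) (l : List ℕ) : List ℕ := (l.map (m + 1 - ·)).reverse

theorem reverseComplement_reverseComplement {m : ℕ} {l : List ℕ} (h : HasLetters m l) :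
    reverseComplement m (reverseComplement m l) = l := by
  rw [reverseComplement, reverseComplement, List.map_reverse, List.reverse_reverse, List.map_map]
  conv_rhs => rw [← List.map_id l]
  refine List.map_congr_left fun x hx => ?_
  have := (h x).1 hx
  simp only [Function.comp, id]
  omega

theorem length_reverseComplement (m : ℕ) (l : List ℕ) :
    (reverseComplement m l).length = l.length := by
  simp [reverseComplement]

theorem HasLetters.reverseComplement {m : ℕ} {l : List ℕ} (h : HasLetters m l) :
    HasLetters m (reverseComplement m l) := by
  intro x
  simp only [_root_.reverseComplement, List.mem_reverse, List.mem_map, h _]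
  constructor
  · rintro ⟨y, hy, rfl⟩
    omega
  · intro hx
    exact ⟨m + 1 - x, by omega, by omega⟩

theorem pairwise_le_reverseComplement {l : List ℕ} (h : l.Pairwise (· ≤ ·)) (m : ℕ) :
    (reverseComplement m l).Pairwise (· ≤ ·) := by
  rw [reverseComplement, List.pairwise_reverse]
  exact h.map _ fun a b hab => Nat.sub_le_sub_left hab _

theorem IsLayered.reverseComplement {m : ℕ} {l : List ℕ} (h : IsLayered m l) :
    IsLayered m (reverseComplement m l) :=
  ⟨pairwise_le_reverseComplement h.1 m, h.2.reverseComplement⟩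

theorem IsCore.reverseComplement {s t : ℕ} {c : List ℕ} (h : IsCore s c t) :
    IsCore s (reverseComplement s c) t where
  two_le := h.two_le
  letters := h.letters.reverseComplement
  head := by simp [_root_.reverseComplement, h.last]
  last := by simp [_root_.reverseComplement, h.head]
  two_or_sorted := h.two_or_sorted.imp_right fun hc => pairwise_le_reverseComplement hc s
  not_sorted ht hc := h.not_sorted ht <| by
    rw [← reverseComplement_reverseComplement h.letters]
    exact pairwise_le_reverseComplement hc s

theorem IsCoreOrEmpty.reverseComplement {s t : ℕ} {c : List ℕ} (h : IsCoreOrEmpty s c t) :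
    IsCoreOrEmpty s (reverseComplement s c) t := by
  rcases h with ⟨rfl, rfl, rfl⟩ | h
  · exact Or.inl ⟨rfl, rfl, rfl⟩
  · exact Or.inr h.reverseComplement

/-- Reverse complementation turns `ls` into `rb`. -/
theorem rightCount_lt_reverseComplement {m : ℕ} {l : List ℕ} (h : HasLetters m l) :
    rightCount (· < ·) (reverseComplement m l) = rightCount (· > ·) l.reverse := by
  rw [reverseComplement, ← List.map_reverse]
  have hl : ∀ x ∈ l.reverse, 1 ≤ x ∧ x ≤ m := fun x hx => (h x).1 (List.mem_reverse.1 hx)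
  refine rightCount_map (fun x hx y hy hxy => ?_) fun x hx y hy => ?_
  · have h1 := hl x hx
    have h2 := hl y hy
    omega
  · have h1 := hl x hx
    have h2 := hl y hy
    omega

/-- Reverse complementation turns `rb` into `ls`. -/
theorem rightCount_gt_reverse_reverseComplement {m : ℕ} {l : List ℕ} (h : HasLetters m l) :
    rightCount (· > ·) (reverseComplement m l).reverse = rightCount (· < ·) l := by
  rw [← rightCount_lt_reverseComplement h.reverseComplement,
    reverseComplement_reverseComplement h]

/-! ### The statistics of a direct sum -/

theorem HasLetters.card_toFinset {m : ℕ} {l : List ℕ} (h : HasLetters m l) :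
    l.toFinset.card = m := by
  have : l.toFinset = Finset.Icc 1 m := by
    ext x
    simp [h x]
  simp [this]

theorem HasLetters.card_toFinset_map_add {m : ℕ} {l : List ℕ} (h : HasLetters m l) (a : ℕ) :
    (l.map (· + a)).toFinset.card = m := by
  have : (l.map (· + a)).toFinset = l.toFinset.image (· + a) := by
    ext x
    simp
  rw [this, Finset.card_image_of_injective _ (add_left_injective a), h.card_toFinset]

section statistics

variable {a b : ℕ} {P Q : List ℕ}

theorem HasLetters.lt_of_mem_shift (hP : HasLetters a P) (hQ : HasLetters b Q) :
    ∀ p ∈ P, ∀ q ∈ Q.map (· + a), p < q := fun p hp _ hq =>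
  ((hP p).1 hp).2.trans_lt (lt_of_mem_map_add hQ hq)

theorem rightCount_lt_shiftAppend (hP : HasLetters a P) (hQ : HasLetters b Q) :
    rightCount (· < ·) (shiftAppend a P Q)
      = rightCount (· < ·) P + P.length * b + rightCount (· < ·) Q := by
  rw [shiftAppend, rightCount_append_of_forall (by simp) (hP.lt_of_mem_shift hQ),
    rightCount_map_add _ _ (by simp), hQ.card_toFinset_map_add]

theorem rightCount_gt_shiftAppend (hP : HasLetters a P) (hQ : HasLetters b Q) :
    rightCount (· > ·) (shiftAppend a P Q) = rightCount (· > ·) P + rightCount (· > ·) Q := by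
  rw [shiftAppend, rightCount_append_of_forall_not, rightCount_map_add _ _ (by simp)]
  exact fun p hp q hq => (hP.lt_of_mem_shift hQ p hp q hq).not_gt

theorem rightCount_gt_reverse_shiftAppend (hP : HasLetters a P) (hQ : HasLetters b Q) :
    rightCount (· > ·) (shiftAppend a P Q).reverse
      = rightCount (· > ·) Q.reverse + Q.length * a + rightCount (· > ·) P.reverse := by
  rw [shiftAppend, List.reverse_append, rightCount_append_of_forall (by simp), ← List.map_reverse,
    rightCount_map_add _ _ (by simp), List.toFinset_reverse, hP.card_toFinset, List.length_map,
    List.length_reverse]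
  exact fun q hq p hp => hP.lt_of_mem_shift hQ p (List.mem_reverse.1 hp) q (List.mem_reverse.1 hq)

theorem rightCount_lt_reverse_shiftAppend (hP : HasLetters a P) (hQ : HasLetters b Q) :
    rightCount (· < ·) (shiftAppend a P Q).reverse
      = rightCount (· < ·) Q.reverse + rightCount (· < ·) P.reverse := by
  rw [shiftAppend, List.reverse_append, rightCount_append_of_forall_not, ← List.map_reverse,
    rightCount_map_add _ _ (by simp)]
  exact fun q hq p hp =>
    (hP.lt_of_mem_shift hQ p (List.mem_reverse.1 hp) q (List.mem_reverse.1 hq)).not_gt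

end statistics

theorem rightCount_lt_coreWord {s : ℕ} {c : List ℕ} (h : HasLetters s c) (t : ℕ) :
    rightCount (· < ·) (coreWord c t) = rightCount (· < ·) c := by
  rw [coreWord, rightCount_append_of_forall_not, rightCount_replicate (by simp), add_zero]
  intro p hp q hq
  have := (h p).1 hp
  rw [List.eq_of_mem_replicate hq]
  omega

theorem rightCount_gt_reverse_coreWord {s : ℕ} {c : List ℕ} (h : HasLetters s c) (t : ℕ) :
    rightCount (· > ·) (coreWord c t).reverse = rightCount (· > ·) c.reverse := by
  rw [coreWord, List.reverse_append, List.reverse_replicate, rightCount_append_of_forall_not,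
    rightCount_replicate (by simp), zero_add]
  intro q hq p hp
  have := (h p).1 (List.mem_reverse.1 hp)
  rw [List.eq_of_mem_replicate hq]
  omega

/-! ### The common parametrization of the two classes -/

/-- A layered word `P` with letters `1, …, r` together with a core or empty word `c 1ᵗ` with letters
`1, …, s`. -/
@[ext]
structure LayeredCorePair where
  r : ℕ
  s : ℕ
  P : List ℕ
  c : List ℕ
  t : ℕ

namespace LayeredCorePair

/-- The data are as described, and the words have total length `n`. -/
def IsValid (n : ℕ) (d : LayeredCorePair) : Prop :=
  IsLayered d.r d.P ∧ IsCoreOrEmpty d.s d.c d.t ∧ d.P.length + (coreWord d.c d.t).length = n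

/-- The direct sum with the layered word on the left. -/
def layeredFirst (d : LayeredCorePair) : List ℕ := shiftAppend d.r d.P (coreWord d.c d.t)

/-- The direct sum with the core on the left. -/
def coreFirst (d : LayeredCorePair) : List ℕ := shiftAppend d.s (coreWord d.c d.t) d.P

/-- Reverse complementation of the layered word and of the part of the core up to its last
maximum. -/
def dual (d : LayeredCorePair) : LayeredCorePair :=
  ⟨d.r, d.s, reverseComplement d.r d.P, reverseComplement d.s d.c, d.t⟩

theorem IsValid.dual {n : ℕ} {d : LayeredCorePair} (h : d.IsValid n) : d.dual.IsValid n := by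
  refine ⟨h.1.reverseComplement, h.2.1.reverseComplement, ?_⟩
  rw [← h.2.2]
  simp [LayeredCorePair.dual, coreWord, length_reverseComplement]

theorem IsValid.dual_dual {n : ℕ} {d : LayeredCorePair} (h : d.IsValid n) : d.dual.dual = d := by
  ext1
  · rfl
  · rfl
  · exact reverseComplement_reverseComplement h.1.2
  · exact reverseComplement_reverseComplement h.2.1.hasLetters
  · rfl

theorem bijOn_layeredFirst (n : ℕ) : Set.BijOn layeredFirst {d | d.IsValid n}
    {l | (IsRGF l ∧ Avoids1213 l) ∧ l.length = n} := by
  refine ⟨fun d hd => ⟨⟨?_, ?_⟩, ?_⟩, fun d hd d' hd' e => ?_, fun l hl => ?_⟩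
  · exact hd.1.isRGF.shiftAppend hd.1.2 hd.2.1.isRGF
  · exact hd.2.1.avoids1213.shiftAppend hd.1 hd.2.1.hasLetters_coreWord
  · simpa [layeredFirst, shiftAppend] using hd.2.2
  · obtain ⟨h1, h2, h3, h4, h5⟩ := eq_of_shiftAppend_core_eq hd.1 hd.2.1 hd'.1 hd'.2.1 e
    exact LayeredCorePair.ext h1 h2 h3 h4 h5
  · obtain ⟨r, s, P, c, t, hP, hc, rfl⟩ :=
      exists_eq_shiftAppend_core_of_avoids1213 hl.1.1 hl.1.2
    exact ⟨⟨r, s, P, c, t⟩, ⟨hP, hc, by simpa [shiftAppend] using hl.2⟩, rfl⟩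

theorem bijOn_coreFirst (n : ℕ) : Set.BijOn coreFirst {d | d.IsValid n}
    {l | (IsRGF l ∧ Avoids1232 l) ∧ l.length = n} := by
  refine ⟨fun d hd => ⟨⟨?_, ?_⟩, ?_⟩, fun d hd d' hd' e => ?_, fun l hl => ?_⟩
  · exact hd.2.1.isRGF.shiftAppend hd.2.1.hasLetters_coreWord hd.1.isRGF
  · exact hd.2.1.avoids1232.shiftAppend hd.1 hd.2.1.hasLetters_coreWord
  · simpa [coreFirst, shiftAppend, add_comm] using hd.2.2
  · obtain ⟨h1, h2, h3, h4, h5⟩ := eq_of_shiftAppend_layered_eq hd.1 hd.2.1 hd'.1 hd'.2.1 e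
    exact LayeredCorePair.ext h1 h2 h3 h4 h5
  · obtain ⟨r, s, P, c, t, hP, hc, rfl⟩ :=
      exists_eq_shiftAppend_layered_of_avoids1232 hl.1.1 hl.1.2
    exact ⟨⟨r, s, P, c, t⟩, ⟨hP, hc, by simpa [shiftAppend, add_comm] using hl.2⟩, rfl⟩

theorem ls_layeredFirst {n : ℕ} {d : LayeredCorePair} (h : d.IsValid n) :
    rightCount (· > ·) d.layeredFirst.reverse = rightCount (· < ·) d.dual.coreFirst := by
  have h' := h.dual
  rw [layeredFirst, rightCount_gt_reverse_shiftAppend h.1.2 h.2.1.hasLetters_coreWord,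
    rightCount_gt_reverse_coreWord h.2.1.hasLetters, coreFirst,
    rightCount_lt_shiftAppend h'.2.1.hasLetters_coreWord h'.1.2,
    rightCount_lt_coreWord h'.2.1.hasLetters]
  simp [LayeredCorePair.dual, rightCount_lt_reverseComplement h.1.2,
    rightCount_lt_reverseComplement h.2.1.hasLetters, coreWord, length_reverseComplement]

theorem rb_layeredFirst {n : ℕ} {d : LayeredCorePair} (h : d.IsValid n) :
    rightCount (· < ·) d.layeredFirst = rightCount (· > ·) d.dual.coreFirst.reverse := by
  have h' := h.dual
  rw [layeredFirst, rightCount_lt_shiftAppend h.1.2 h.2.1.hasLetters_coreWord,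
    rightCount_lt_coreWord h.2.1.hasLetters, coreFirst,
    rightCount_gt_reverse_shiftAppend h'.2.1.hasLetters_coreWord h'.1.2,
    rightCount_gt_reverse_coreWord h'.2.1.hasLetters]
  simp [LayeredCorePair.dual, rightCount_gt_reverse_reverseComplement h.1.2,
    rightCount_gt_reverse_reverseComplement h.2.1.hasLetters, length_reverseComplement]

theorem lb_layeredFirst {n : ℕ} {d : LayeredCorePair} (h : d.IsValid n) :
    rightCount (· < ·) d.layeredFirst.reverse = rightCount (· < ·) d.coreFirst.reverse := by
  rw [layeredFirst, rightCount_lt_reverse_shiftAppend h.1.2 h.2.1.hasLetters_coreWord, coreFirst,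
    rightCount_lt_reverse_shiftAppend h.2.1.hasLetters_coreWord h.1.2, add_comm]

theorem rs_layeredFirst {n : ℕ} {d : LayeredCorePair} (h : d.IsValid n) :
    rightCount (· > ·) d.layeredFirst = rightCount (· > ·) d.coreFirst := by
  rw [layeredFirst, rightCount_gt_shiftAppend h.1.2 h.2.1.hasLetters_coreWord, coreFirst,
    rightCount_gt_shiftAppend h.2.1.hasLetters_coreWord h.1.2, add_comm]

end LayeredCorePair

/-! ### Counting -/

theorem ncard_words_eq {n : ℕ} {α : Type*} {D : Set α} {φ : α → List ℕ} {p : List ℕ → Prop}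
    (hφ : Set.BijOn φ D {l | p l ∧ l.length = n}) {R : Set (Fin n → ℕ)}
    (hR : ∀ w, w ∈ R ↔ p (List.ofFn w)) (g : List ℕ → ℕ) (v : ℕ) :
    {w ∈ R | g (List.ofFn w) = v}.ncard = {d ∈ D | g (φ d) = v}.ncard := by
  rw [← Set.ncard_image_of_injective {w ∈ R | g (List.ofFn w) = v} List.ofFn_injective,
    ← (hφ.injOn.mono (Set.sep_subset D fun d => g (φ d) = v)).ncard_image]
  congr 1
  ext l
  constructor
  · rintro ⟨w, ⟨hw, hv⟩, rfl⟩
    obtain ⟨d, hd, hdw⟩ := hφ.surjOn (show List.ofFn w ∈ {l | p l ∧ l.length = n} from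
      ⟨(hR w).1 hw, List.length_ofFn⟩)
    exact ⟨d, ⟨hd, by rwa [hdw]⟩, hdw⟩
  · rintro ⟨d, ⟨hd, hv⟩, rfl⟩
    obtain ⟨hp, hlen⟩ := hφ.mapsTo hd
    subst hlen
    exact ⟨(φ d).get, ⟨(hR _).2 (by rwa [List.ofFn_get]), by rwa [List.ofFn_get]⟩,
      List.ofFn_get _⟩

theorem equidistributed_of_involution {n : ℕ} (θ : LayeredCorePair → LayeredCorePair)
    (hθ : ∀ d, d.IsValid n → (θ d).IsValid n) (hθθ : ∀ d, d.IsValid n → θ (θ d) = d)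
    {f f' : (Fin n → ℕ) → ℕ} {g g' : List ℕ → ℕ} (hf : ∀ w, f w = g (List.ofFn w))
    (hf' : ∀ w, f' w = g' (List.ofFn w))
    (hg : ∀ d, d.IsValid n → g d.layeredFirst = g' (θ d).coreFirst) :
    Equidistributed f (avoidanceWords n SetPartition.pattern13_2_4)
      f' (avoidanceWords n SetPartition.pattern1_24_3) := by
  intro v
  simp only [hf, hf']
  rw [ncard_words_eq (LayeredCorePair.bijOn_layeredFirst n) mem_avoidanceWords_13_2_4_iff,
    ncard_words_eq (LayeredCorePair.bijOn_coreFirst n) mem_avoidanceWords_1_24_3_iff]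
  refine Set.ncard_congr (fun d _ => θ d) ?_ ?_ ?_
  · rintro d ⟨hd, hv⟩
    exact ⟨hθ d hd, (hg d hd).symm.trans hv⟩
  · rintro d d' ⟨hd, -⟩ ⟨hd', -⟩ e
    rw [← hθθ d hd, ← hθθ d' hd', e]
  · rintro d ⟨hd, hv⟩
    exact ⟨θ d, ⟨hθ d hd, by rw [hg _ (hθ d hd), hθθ d hd, hv]⟩, hθθ d hd⟩

theorem theorem5p1 (n : ℕ) :
    Equidistributed WachsWhite.ls (avoidanceWords n SetPartition.pattern13_2_4)
      WachsWhite.rb (avoidanceWords n SetPartition.pattern1_24_3) ∧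
    Equidistributed WachsWhite.rb (avoidanceWords n SetPartition.pattern13_2_4)
      WachsWhite.ls (avoidanceWords n SetPartition.pattern1_24_3) ∧
    Equidistributed WachsWhite.lb (avoidanceWords n SetPartition.pattern13_2_4)
      WachsWhite.lb (avoidanceWords n SetPartition.pattern1_24_3) ∧
    Equidistributed WachsWhite.rs (avoidanceWords n SetPartition.pattern13_2_4)
      WachsWhite.rs (avoidanceWords n SetPartition.pattern1_24_3) := by
  refine ⟨?_, ?_, ?_, ?_⟩
  · exact equidistributed_of_involution LayeredCorePair.dual (fun _ h => h.dual)
      (fun _ h => h.dual_dual) (g := fun l => rightCount (· > ·) l.reverse)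
      WachsWhite.ls_eq_rightCount WachsWhite.rb_eq_rightCount
      fun _ h => LayeredCorePair.ls_layeredFirst h
  · exact equidistributed_of_involution LayeredCorePair.dual (fun _ h => h.dual)
      (fun _ h => h.dual_dual) (g' := fun l => rightCount (· > ·) l.reverse)
      WachsWhite.rb_eq_rightCount WachsWhite.ls_eq_rightCount
      fun _ h => LayeredCorePair.rb_layeredFirst h
  · exact equidistributed_of_involution id (fun _ h => h) (fun _ _ => rfl)
      (g := fun l => rightCount (· < ·) l.reverse) (g' := fun l => rightCount (· < ·) l.reverse)
      WachsWhite.lb_eq_rightCount WachsWhite.lb_eq_rightCount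
      fun _ h => LayeredCorePair.lb_layeredFirst h
  · exact equidistributed_of_involution id (fun _ h => h) (fun _ _ => rfl)
      WachsWhite.rs_eq_rightCount WachsWhite.rs_eq_rightCount
      fun _ h => LayeredCorePair.rs_layeredFirst h
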